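/- Let $n,p,k$ be integers with $p\ge 2$, $k\ge 1$, and let $\sigma>0$, $\tau_1>0$. For $X\in\mathbb{R}^{n\times p}$ with columns $X_1,\dots,X_p$ and a model $z\subseteq\{1,\dots,p\}$, let $X_z$ be the submatrix of the columns in $z$, let $A_z:=I_n+\frac{\tau_1^2}{\sigma^2}X_zX_z^\top$, and $$\mathcal{C}(k):=\max_{|z|\le k}\ \max_{j\ne i,\ j\notin z}\bigl|X_j^\top A_z^{-1}X_i\bigr|,\qquad \omega(k):=\min_{|z|\le k}\ \min\bigl\{v^\top X^\top A_z^{-1}Xv:\ \|v\|_2=1,\ \|v\|_0\le k,\ v_j=0\ \forall j\in z\bigr\}.$$ For $z^*\subseteq\{1,\dots,p\}$, real $s\ge0$, $B\ge 0$ and $\epsilon\in\mathbb{R}^n$, let $\mathcal{N}_s(B)$ be the event $$\max_{z^*\subseteq z,\ |z|\le |z^*|+s}\ \max_{j\notin z}\bigl|\langle A_z^{-1}X_j,\epsilon\rangle\bigr|\le B ,$$ and put $B_s:=\sigma\sqrt{2(s+1)n\log p}$. Let $\epsilon\sim\mathcal{N}(0,\sigma^2I_n)$. By a Gaussian design we mean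 $X$ with i.i.d. entries $X_{ij}\sim\mathcal{N}(0,1)$, independent of $\epsilon$. All constants depend only on what is indicated, and in particular not on $n,p,k,\sigma,\tau_1,z^*,\beta^*$. 1. (Noise condition.) (a) There is an absolute constant $C$ such that for every fixed $X$ with $\|X_j\|_2^2\le n$ for all $j$ (in particular under the normalization $\|X_j\|_2^2=n$), every $z^*$ and every $s\ge 0$, the event $\mathcal{N}_s(B_s)$ has probability at least $1-C/\sqrt{\log p}$ over $\epsilon$. (b) For every $\eta>0$ there are $C_0>0$ and $C$, depending only on $\eta$, such that for a Gaussian design with $n\ge C_0\log p$, every $z^*$ and every $s\ge 0$, the event $\mathcal{N}_s((1+\eta)B_s)$ has probability at least $1-C/\sqrt{\log p}$ over $(X,\epsilon)$. (c) For all $\kappa>0$, $s\ge 0$ and $\eta>0$ there is $p_0$ such that for a Gaussian design with $p\ge p_0$ and $(\log p)^2\le\kappa n$, and every $z^*$, the event $\mathcal{N}_s(B_s)$ has probability at least $1-\eta$ over $(X,\epsilon)$. 2. (Coherence.) For all $c_0,\kappa>0$ there are $C,C'$, depending only on $c_0,\kappa$, such that for a Gaussian design with $c_0k\log p\le n\le\kappa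 k\log p$ (that is, $k\asymp n/\log p$), $\mathcal{C}(k)\le C k^2\log p$ with probability at least $1-C'/p$. 3. (Restricted eigenvalue.) There are absolute constants $C_0,c>0$ and $C$ such that for a Gaussian design with $n\ge C_0k\log p$, $\omega(k)\ge c\,n$ with probability at least $1-C/p$; in particular $\omega(k)$ is bounded away from $0$. 4. (Lasso.) There is an absolute constant $a_0>0$ such that for every $a\ge a_0$ there are $C_0,C_\beta>0$ and $C,C'$, depending only on $a$, with the following property. Let $X$ be a Gaussian design with $n\ge C_0k\log p$, let $\beta^*\in\mathbb{R}^p$ be fixed with $\|\beta^*\|_0\le k$ and $|\beta^*_j|\ge C_\beta\,\sigma\sqrt{\log(p)/n}$ whenever $\beta^*_j\ne0$, and let $y=X\beta^*+\epsilon$ and $\lambda=a\,\sigma\sqrt{n\log p}$. Then with probability at least $1-C'/p$ over $(X,\epsilon)$, the Lasso objective $b\mapsto\|y-Xb\|_2^2+\lambda\sum_{j}|b_j|$ has a minimizer, and every minimizer $\hat\beta$ has no false negatives ($\hat\beta_j\neq0$ whenever $\beta^*_j\ne0$) and at most $Ck$ false positives (indices $j$ with $\hat\beta_j\ne0$ and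 $\beta^*_j=0$). -/

import Mathlib

open MeasureTheory ProbabilityTheory Matrix

noncomputable section

namespace WarmStart

variable {n p : ℕ}

/-- A model is a set `z` of active columns. `subDesign X z` is the submatrix `X_z` of the columns
of `X` that are active in `z`. -/
def subDesign (X : Matrix (Fin n) (Fin p) ℝ) (z : Finset (Fin p)) : Matrix (Fin n) z ℝ :=
  X.submatrix id (fun j : z => (j : Fin p))

/-- `(I_n + (τ₁² / σ²) X_z X_zᵀ)⁻¹`; the matrix that is inverted is positive definite. -/
def modelInv (σ τ₁ : ℝ) (X : Matrix (Fin n) (Fin p) ℝ) (z : Finset (Fin p)) :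
    Matrix (Fin n) (Fin n) ℝ :=
  (1 + (τ₁ ^ 2 / σ ^ 2) • (subDesign X z * (subDesign X z)ᵀ))⁻¹

/-- The maximum over the models `z ⊇ zstar` with at most `s` additional active columns, and over
the columns `j ∉ z`, of `|⟨(I_n + (τ₁² / σ²) X_z X_zᵀ)⁻¹ X_j, ε⟩|` is at most `B`. -/
def NoiseBound (σ τ₁ s : ℝ) (zstar : Finset (Fin p)) (B : ℝ)
    (X : Matrix (Fin n) (Fin p) ℝ) (ε : Fin n → ℝ) : Prop :=
  ∀ z : Finset (Fin p), zstar ⊆ z → (z.card : ℝ) ≤ (zstar.card : ℝ) + s →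
    ∀ j : Fin p, j ∉ z → |(modelInv σ τ₁ X z *ᵥ (fun i => X i j)) ⬝ᵥ ε| ≤ B

/-- The coherence `C(k)`: the maximum of `|X_jᵀ (I_n + (τ₁² / σ²) X_z X_zᵀ)⁻¹ X_i|` over models
`z` of size at most `k` and columns `j ≠ i` with `j ∉ z`. -/
def coherence (σ τ₁ : ℝ) (X : Matrix (Fin n) (Fin p) ℝ) (k : ℕ) : ℝ :=
  sSup {r : ℝ | ∃ (z : Finset (Fin p)) (j i : Fin p), z.card ≤ k ∧ j ≠ i ∧ j ∉ z ∧
    r = |(fun l => X l j) ⬝ᵥ (modelInv σ τ₁ X z *ᵥ (fun l => X l i))|}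

/-- The restricted eigenvalue `ω(k)`: the minimum of
`vᵀ X_{1-z}ᵀ (I_n + (τ₁² / σ²) X_z X_zᵀ)⁻¹ X_{1-z} v` over models `z` of size at most `k` and unit
vectors `v` on the complement of `z` with at most `k` non-zero entries. Such a `v` is represented
by its extension by zero to all coordinates, so that `X_{1-z} v = X v`. -/
def restrictedEigenvalue (σ τ₁ : ℝ) (X : Matrix (Fin n) (Fin p) ℝ) (k : ℕ) : ℝ :=
  sInf {r : ℝ | ∃ (z : Finset (Fin p)) (v : Fin p → ℝ), z.card ≤ k ∧ (∀ j ∈ z, v j = 0) ∧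
    {j | v j ≠ 0}.ncard ≤ k ∧ ∑ j, v j ^ 2 = 1 ∧
    r = (X *ᵥ v) ⬝ᵥ (modelInv σ τ₁ X z *ᵥ (X *ᵥ v))}

/-- `b` minimizes the Lasso objective `‖y - X b‖₂² + lam ‖b‖₁`. -/
def IsLasso (X : Matrix (Fin n) (Fin p) ℝ) (y : Fin n → ℝ) (lam : ℝ) (b : Fin p → ℝ) : Prop :=
  ∀ b' : Fin p → ℝ,
    ∑ i, (y i - (X *ᵥ b) i) ^ 2 + lam * ∑ j, |b j| ≤
      ∑ i, (y i - (X *ᵥ b') i) ^ 2 + lam * ∑ j, |b' j|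

/-- The law of the entries `X_ij` of an `n × p` matrix with independent `N(0, 1)` entries. -/
def gaussianDesign (n p : ℕ) : Measure (Fin n → Fin p → ℝ) :=
  Measure.pi (fun _ : Fin n => Measure.pi (fun _ : Fin p => gaussianReal 0 1))

/-- The law `N(0, σ² I_n)` of the noise. -/
def noiseLaw (n : ℕ) (σ : ℝ) : Measure (Fin n → ℝ) :=
  Measure.pi (fun _ : Fin n => gaussianReal 0 (σ ^ 2).toNNReal)

end WarmStart

end

noncomputable section

namespace WarmStart

variable {n p : ℕ}

/-! ### Gaussian tails -/

/-! Everything about `A_z⁻¹` comes from one identity: `x = A_z⁻¹ w` satisfies `x + (τ₁² / σ²) X_z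
X_zᵀ x = w`. Pairing it with `x` gives `‖x‖² ≤ ⟨w, x⟩`, so `A_z⁻¹` is a contraction whatever `z`,
`σ` and `τ₁` are.

Noise: each linear form in `ε` thus has variance at most `σ² ‖X_j‖²`. About `p^(s+1)` pairs `(z, j)`
compete, `B_s` is the level at which the Gaussian exponential cancels this count, and the factor `1
/ t` in Mills' bound is what remains. For a Gaussian design, chi-square tails control the column
norms at the cost of `1 + η`. The sharp constant comes from averaging the tail over the column norm
instead of bounding the largest norm; the correction is `exp(O((log p)² / n))`.

Coherence: contraction bounds it by the largest squared column norm, which is of order `n`, hence of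
order `k log p`, already below `k² log p`.

Restricted eigenvalue: by the identity, `A_z⁻¹ X v = X (v - u)` with `u` supported on `z`. The
vector `v - u` is `2k`-sparse and agrees with `v` off `z`, so a lower bound on `2k`-sparse singular
values (`gaussianDesign_sparseLowerBound`, by nets) suffices.

Lasso: a primal-dual witness gives exact support recovery (`lasso_support_recovery`). The
certificate `X_R (X_Rᵀ X_R)⁻¹ s` has squared norm of order `k / n` and is independent of any column
outside `R`, so its product with that column is at most `1/2`. Applied with `R = S \ {j}`, the same
fact bounds the coordinates of `(X_Sᵀ X_S)⁻¹ s` without a factor `√k` (`abs_gramSolve_le`). -/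

instance (n : ℕ) (σ : ℝ) : IsProbabilityMeasure (noiseLaw n σ) := by
  unfold noiseLaw; infer_instance

instance (n p : ℕ) : IsProbabilityMeasure (gaussianDesign n p) := by
  unfold gaussianDesign; infer_instance

/-- A linear combination of independent centred Gaussian variables is Gaussian. -/
theorem map_dotProduct_pi_gaussianReal {ι : Type*} [Fintype ι] (v : NNReal) (a : ι → ℝ) :
    (Measure.pi (fun _ : ι => gaussianReal 0 v)).map (fun ε => a ⬝ᵥ ε)
      = gaussianReal 0 (v * (∑ i, a i ^ 2).toNNReal) := by
  have hm : Measurable (fun ε : ι → ℝ => a ⬝ᵥ ε) := by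
    unfold dotProduct; fun_prop
  have : IsProbabilityMeasure ((Measure.pi (fun _ : ι => gaussianReal 0 v)).map
      (fun ε => a ⬝ᵥ ε)) := Measure.isProbabilityMeasure_map hm.aemeasurable
  refine Measure.ext_of_charFun (funext fun t => ?_)
  rw [charFun_apply_real, integral_map hm.aemeasurable (by fun_prop)]
  have h1 : ∀ ε : ι → ℝ, Complex.exp (t * ((a ⬝ᵥ ε : ℝ) : ℂ) * Complex.I)
      = ∏ i, Complex.exp (((t * a i : ℝ) : ℂ) * (ε i) * Complex.I) := by
    intro ε
    rw [← Complex.exp_sum]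
    congr 1
    simp only [dotProduct, Complex.ofReal_sum, Complex.ofReal_mul, Finset.mul_sum,
      Finset.sum_mul]
    exact Finset.sum_congr rfl fun i _ => by ring
  simp_rw [h1]
  rw [integral_fintype_prod_eq_prod
    (f := fun i (x : ℝ) => Complex.exp (((t * a i : ℝ) : ℂ) * x * Complex.I))]
  simp_rw [← charFun_apply_real, charFun_gaussianReal]
  rw [← Complex.exp_sum]
  congr 1
  have h2 : (((v * (∑ i, a i ^ 2).toNNReal : NNReal) : ℝ) : ℂ)
      = (v : ℂ) * ∑ i, (a i : ℂ) ^ 2 := by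
    rw [NNReal.coe_mul, Real.coe_toNNReal _ (Finset.sum_nonneg fun i _ => sq_nonneg _)]
    push_cast; rfl
  simp only [h2]
  push_cast
  simp only [mul_zero, zero_mul, zero_sub, Finset.mul_sum, Finset.sum_mul, Finset.sum_div,
    ← Finset.sum_neg_distrib]
  exact Finset.sum_congr rfl fun i _ => by ring

/-- Mills' bound for the standard Gaussian tail. -/
theorem gaussianReal_tail_le {t : ℝ} (ht : 0 < t) :
    gaussianReal 0 1 {x | t < |x|} ≤ ENNReal.ofReal (Real.exp (-t ^ 2 / 2) / t) := by
  have hone : gaussianReal 0 1 (Set.Ioi t)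
      ≤ ENNReal.ofReal (Real.exp (-t ^ 2 / 2) / t / 2) := by
    rw [gaussianReal_apply_eq_integral 0 one_ne_zero]
    apply ENNReal.ofReal_le_ofReal
    have hderiv : ∀ x ∈ Set.Ici t,
        HasDerivAt (fun x : ℝ => -Real.exp (-x ^ 2 / 2)) (x * Real.exp (-x ^ 2 / 2)) x := by
      intro x _
      have := (((hasDerivAt_pow 2 x).neg.div_const 2).exp).neg
      refine this.congr_deriv ?_
      simp
      ring
    have hlim : Filter.Tendsto (fun x : ℝ => -Real.exp (-x ^ 2 / 2)) Filter.atTop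
        (nhds (-0)) := by
      apply Filter.Tendsto.neg
      apply Real.tendsto_exp_atBot.comp
      have h := (Filter.tendsto_pow_atTop (α := ℝ) two_ne_zero)
      have h2 := Filter.tendsto_neg_atTop_atBot.comp h
      exact h2.atBot_div_const two_pos
    have hnn : ∀ x ∈ Set.Ioi t, 0 ≤ x * Real.exp (-x ^ 2 / 2) := fun x hx =>
      mul_nonneg (ht.le.trans (le_of_lt hx)) (Real.exp_pos _).le
    have hint := integrableOn_Ioi_deriv_of_nonneg' hderiv hnn hlim
    have hval := integral_Ioi_of_hasDerivAt_of_nonneg' hderiv hnn hlim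
    -- The factor `x / t ≥ 1` turns the density into an exact derivative. Using `√(2π) ≥ 2` leaves a
    -- factor `1/2`, which the two tails together consume.
    have hle : ∫ x in Set.Ioi t, gaussianPDFReal 0 1 x
        ≤ ∫ x in Set.Ioi t, (1 / (2 * t)) * (x * Real.exp (-x ^ 2 / 2)) := by
      apply setIntegral_mono_on (integrable_gaussianPDFReal 0 1).integrableOn
        (hint.const_mul _) measurableSet_Ioi
      intro x hx
      have hx' : t < x := hx
      have hpi : (2 : ℝ) ≤ √(2 * Real.pi) := by
        apply Real.le_sqrt_of_sq_le
        nlinarith [Real.pi_gt_three]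
      have hinv : (√(2 * Real.pi))⁻¹ ≤ 2⁻¹ := inv_anti₀ two_pos hpi
      have hxt : 1 ≤ x / t := by rw [le_div_iff₀ ht]; linarith
      simp only [gaussianPDFReal, NNReal.coe_one, mul_one, sub_zero]
      have hE := Real.exp_pos (-x ^ 2 / 2)
      calc (√(2 * Real.pi))⁻¹ * Real.exp (-x ^ 2 / 2)
          ≤ 2⁻¹ * Real.exp (-x ^ 2 / 2) := by gcongr
        _ ≤ (2⁻¹ * Real.exp (-x ^ 2 / 2)) * (x / t) := le_mul_of_one_le_right (by positivity) hxt
        _ = _ := by field_simp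
    rw [integral_const_mul, hval] at hle
    refine hle.trans (le_of_eq ?_)
    field_simp
    ring
  have hneg : gaussianReal 0 1 (Set.Iio (-t)) = gaussianReal 0 1 (Set.Ioi t) := by
    have h : (gaussianReal 0 1).map (fun x => -x) = gaussianReal 0 1 := by
      rw [gaussianReal_map_neg, neg_zero]
    conv_rhs => rw [← h]
    rw [Measure.map_apply measurable_neg measurableSet_Ioi]
    congr 1
    ext x; simp
  have hsub : {x : ℝ | t < |x|} ⊆ Set.Ioi t ∪ Set.Iio (-t) := by
    intro x hx
    rcases lt_abs.1 (show t < |x| from hx) with h | h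
    · exact Or.inl h
    · exact Or.inr (by simp only [Set.mem_Iio]; linarith)
  refine (measure_mono hsub).trans ((measure_union_le _ _).trans ?_)
  rw [hneg]
  refine (add_le_add hone hone).trans ?_
  rw [← ENNReal.ofReal_add (by positivity) (by positivity)]
  exact ENNReal.ofReal_le_ofReal (by linarith)

/-- The tail of a linear form in the noise. -/
theorem noiseLaw_tail_le {σ : ℝ} (hσ : 0 < σ) (a : Fin n → ℝ) {V t : ℝ}
    (ha : ∑ i, a i ^ 2 ≤ V) (ht : 0 < t) :
    noiseLaw n σ {ε | t * (σ * √V) < |a ⬝ᵥ ε|}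
      ≤ ENNReal.ofReal (Real.exp (-t ^ 2 / 2) / t) := by
  have hm : Measurable (fun ε : Fin n → ℝ => a ⬝ᵥ ε) := by
    unfold dotProduct; fun_prop
  set S := ∑ i, a i ^ 2 with hS
  have hS0 : 0 ≤ S := Finset.sum_nonneg fun i _ => sq_nonneg _
  have hvar : (σ ^ 2).toNNReal * S.toNNReal
      = NNReal.mk ((σ * √S) ^ 2) (sq_nonneg _) * 1 := by
    ext
    rw [NNReal.coe_mul, mul_one, NNReal.coe_mk]
    rw [Real.coe_toNNReal _ (sq_nonneg _), Real.coe_toNNReal _ hS0, mul_pow, Real.sq_sqrt hS0]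
  -- This covers `S = 0` as well: both sides are then Dirac masses at `0`.
  have hlaw : (noiseLaw n σ).map (fun ε => a ⬝ᵥ ε)
      = (gaussianReal 0 1).map (fun x => (σ * √S) * x) := by
    rw [noiseLaw, map_dotProduct_pi_gaussianReal, gaussianReal_map_const_mul, hvar, mul_zero]
  have hms : MeasurableSet {x : ℝ | t * (σ * √V) < |x|} :=
    measurableSet_lt measurable_const (by fun_prop)
  have e1 : noiseLaw n σ {ε | t * (σ * √V) < |a ⬝ᵥ ε|}
      = (noiseLaw n σ).map (fun ε => a ⬝ᵥ ε) {x : ℝ | t * (σ * √V) < |x|} := by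
    rw [Measure.map_apply hm hms]; rfl
  rw [e1, hlaw, Measure.map_apply (by fun_prop) hms]
  refine (measure_mono ?_).trans (gaussianReal_tail_le ht)
  intro x hx
  simp only [Set.mem_preimage, Set.mem_ofPred_eq, abs_mul, abs_of_pos hσ,
    abs_of_nonneg (Real.sqrt_nonneg S)] at hx ⊢
  have h1 : √S ≤ √V := Real.sqrt_le_sqrt ha
  have h2 : σ * √S * |x| ≤ σ * √V * |x| := by gcongr
  by_contra! h
  have h3 : σ * √V * |x| ≤ σ * √V * t := by gcongr
  linarith

/-! ### Chi-square tails -/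

/-- Since `(1 - x)(1 + x + x²) = 1 - x³`, the linear bound on `exp` suffices for `x ≤ 0`; for `x ≥
0` the quadratic term of `exp` pays for `x³`. -/
theorem inv_one_sub_le_exp {x : ℝ} (h1 : x ≤ 1 / 2) :
    (1 - x)⁻¹ ≤ Real.exp (x + x ^ 2) := by
  have hpos : 0 < 1 - x := by linarith
  rw [inv_le_iff_one_le_mul₀' hpos]
  rcases le_total 0 x with h0 | h0
  · have := Real.quadratic_le_exp_of_nonneg (show 0 ≤ x + x ^ 2 by positivity)
    calc (1 : ℝ) ≤ (1 - x) * (1 + (x + x ^ 2) + (x + x ^ 2) ^ 2 / 2) := by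
          nlinarith [mul_nonneg h0 h0, mul_nonneg (mul_nonneg h0 h0) (sub_nonneg.2 h1),
            mul_nonneg (mul_nonneg (mul_nonneg h0 h0) h0) (sub_nonneg.2 h1),
            mul_nonneg (mul_nonneg (mul_nonneg (mul_nonneg h0 h0) h0) h0) (sub_nonneg.2 h1)]
      _ ≤ _ := by gcongr
  · have := Real.add_one_le_exp (x + x ^ 2)
    calc (1 : ℝ) ≤ (1 - x) * (x + x ^ 2 + 1) := by
          nlinarith [mul_nonneg (neg_nonneg.2 h0) (sq_nonneg x)]
      _ ≤ _ := by gcongr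

theorem integral_exp_mul_sq_gaussianReal {l : ℝ} (hl : l < 1 / 2) :
    Integrable (fun x : ℝ => Real.exp (l * x ^ 2)) (gaussianReal 0 1) ∧
    ∫ x, Real.exp (l * x ^ 2) ∂(gaussianReal 0 1) = √((1 - 2 * l)⁻¹) := by
  have hb : 0 < (1 - 2 * l) / 2 := by linarith
  have hfun : ∀ x : ℝ, gaussianPDFReal 0 1 x * Real.exp (l * x ^ 2)
      = (√(2 * Real.pi))⁻¹ * Real.exp (-((1 - 2 * l) / 2) * x ^ 2) := by
    intro x
    simp only [gaussianPDFReal, NNReal.coe_one, mul_one, sub_zero]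
    rw [mul_assoc, ← Real.exp_add]
    congr 2; ring
  have hint := (integrable_exp_neg_mul_sq hb).const_mul (√(2 * Real.pi))⁻¹
  constructor
  · rw [gaussianReal_of_var_ne_zero 0 one_ne_zero]
    unfold gaussianPDF
    rw [integrable_withDensity_iff_integrable_smul₀' (by fun_prop) (by simp)]
    refine hint.congr (Filter.Eventually.of_forall fun x => ?_)
    simp only [smul_eq_mul]
    rw [ENNReal.toReal_ofReal (gaussianPDFReal_nonneg _ _ _), hfun]
  · rw [integral_gaussianReal_eq_integral_smul one_ne_zero]
    simp only [smul_eq_mul, hfun]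
    rw [integral_const_mul, integral_gaussian, ← Real.sqrt_inv, ← Real.sqrt_mul (by positivity)]
    congr 1
    have : (1 - 2 * l) ≠ 0 := by linarith
    field_simp

theorem noiseLaw_one (n : ℕ) :
    noiseLaw n 1 = Measure.pi (fun _ : Fin n => gaussianReal 0 1) := by
  simp [noiseLaw]

/-- The exponential moments of a centred chi-square variable. -/
theorem lintegral_exp_chiSq_le (n : ℕ) {l : ℝ} (h1 : l ≤ 1 / 4) :
    ∫⁻ g, ENNReal.ofReal (Real.exp (l * (∑ i, g i ^ 2 - n))) ∂(noiseLaw n 1)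
      ≤ ENNReal.ofReal (Real.exp (2 * n * l ^ 2)) := by
  obtain ⟨hi, hv⟩ := integral_exp_mul_sq_gaussianReal (l := l) (by linarith)
  have hprod : ∀ g : Fin n → ℝ, Real.exp (l * (∑ i, g i ^ 2 - n))
      = ∏ i, (Real.exp (-l) * Real.exp (l * g i ^ 2)) := by
    intro g
    simp_rw [← Real.exp_add, ← Real.exp_sum]
    congr 1
    simp [Finset.sum_add_distrib]
    rw [mul_sub, Finset.mul_sum]; ring
  simp_rw [hprod]
  have hi' : Integrable (fun x : ℝ => Real.exp (-l) * Real.exp (l * x ^ 2)) (gaussianReal 0 1) :=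
    hi.const_mul _
  rw [noiseLaw_one, ← ofReal_integral_eq_lintegral_ofReal
    (Integrable.fintype_prod (f := fun (_ : Fin n) (x : ℝ) => Real.exp (-l) * Real.exp (l * x ^ 2))
      fun _ => hi')
    (Filter.Eventually.of_forall fun g => Finset.prod_nonneg fun i _ => by positivity)]
  apply ENNReal.ofReal_le_ofReal
  rw [integral_fintype_prod_eq_prod
    (f := fun (_ : Fin n) (x : ℝ) => Real.exp (-l) * Real.exp (l * x ^ 2))]
  simp only [integral_const_mul, hv, Finset.prod_const, Finset.card_univ, Fintype.card_fin]
  -- The previous inequality is used at `x = 2l`, which is where `l ≤ 1/4` comes from.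
  have h3 : √((1 - 2 * l)⁻¹) ≤ Real.exp (l + 2 * l ^ 2) := by
    rw [Real.sqrt_le_left (Real.exp_pos _).le, ← Real.exp_nat_mul]
    refine (inv_one_sub_le_exp (by linarith)).trans (le_of_eq ?_)
    congr 1; push_cast; ring
  calc (Real.exp (-l) * √((1 - 2 * l)⁻¹)) ^ n
      ≤ (Real.exp (-l) * Real.exp (l + 2 * l ^ 2)) ^ n := by gcongr
    _ = _ := by
      rw [← Real.exp_add, ← Real.exp_nat_mul]; congr 1; ring

/-- Markov's inequality for `exp f`, the Chernoff step; the `lintegral` form avoids integrability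
conditions. -/
theorem measure_le_of_lintegral_exp {Ω : Type*} [MeasurableSpace Ω] {μ : Measure Ω} {f : Ω → ℝ}
    (hf : Measurable f) {c r : ℝ} (h : ∫⁻ x, ENNReal.ofReal (Real.exp (f x)) ∂μ
      ≤ ENNReal.ofReal (Real.exp c)) :
    μ {x | r ≤ f x} ≤ ENNReal.ofReal (Real.exp (c - r)) := by
  have h1 := mul_meas_ge_le_lintegral (μ := μ) (f := fun x => ENNReal.ofReal (Real.exp (f x)))
    (by fun_prop) (ENNReal.ofReal (Real.exp r))
  have h2 : {x | r ≤ f x} ⊆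
      {x | ENNReal.ofReal (Real.exp r) ≤ ENNReal.ofReal (Real.exp (f x))} := by
    intro x hx
    exact ENNReal.ofReal_le_ofReal (Real.exp_le_exp.2 hx)
  have h3 : ENNReal.ofReal (Real.exp r) * μ {x | r ≤ f x} ≤ ENNReal.ofReal (Real.exp c) :=
    (mul_le_mul_right (measure_mono h2) _).trans (h1.trans h)
  rw [Real.exp_sub, ENNReal.ofReal_div_of_pos (Real.exp_pos _)]
  rw [ENNReal.le_div_iff_mul_le (Or.inl (by simp [Real.exp_pos])) (Or.inl (by simp)), mul_comm]
  exact h3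

theorem chiSq_upper_tail (n : ℕ) {l r : ℝ} (h0 : 0 ≤ l) (h1 : l ≤ 1 / 4) :
    noiseLaw n 1 {g | r ≤ ∑ i, g i ^ 2}
      ≤ ENNReal.ofReal (Real.exp (2 * n * l ^ 2 - l * (r - n))) := by
  refine (measure_mono fun g hg => ?_).trans
    (measure_le_of_lintegral_exp (r := l * (r - n)) (by fun_prop) (lintegral_exp_chiSq_le n h1))
  have hg' : r ≤ ∑ i, g i ^ 2 := hg
  show l * (r - n) ≤ l * (∑ i, g i ^ 2 - n)
  gcongr

theorem chiSq_lower_tail (n : ℕ) {l r : ℝ} (h0 : 0 ≤ l) :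
    noiseLaw n 1 {g | ∑ i, g i ^ 2 ≤ r}
      ≤ ENNReal.ofReal (Real.exp (2 * n * l ^ 2 - l * (n - r))) := by
  refine (measure_mono fun g hg => ?_).trans
    ((measure_le_of_lintegral_exp (r := -l * (r - n)) (by fun_prop)
      (lintegral_exp_chiSq_le n (l := -l) (by linarith))).trans (le_of_eq ?_))
  · have hg' : ∑ i, g i ^ 2 ≤ r := hg
    show -l * (r - n) ≤ -l * (∑ i, g i ^ 2 - n)
    nlinarith
  · congr 2; ring

/-- The image of a Gaussian design under a unit vector is a standard Gaussian vector. -/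
theorem map_mulVec_gaussianDesign {v : Fin p → ℝ} (hv : ∑ j, v j ^ 2 = 1) :
    (gaussianDesign n p).map (fun X => (Matrix.of X) *ᵥ v) = noiseLaw n 1 := by
  have hm : Measurable (fun x : Fin p → ℝ => v ⬝ᵥ x) := by
    unfold dotProduct; fun_prop
  have h1 : (Measure.pi (fun _ : Fin p => gaussianReal 0 1)).map (fun x => v ⬝ᵥ x)
      = gaussianReal 0 1 := by
    rw [map_dotProduct_pi_gaussianReal, hv]; simp
  have h2 : (fun X : Fin n → Fin p → ℝ => (Matrix.of X) *ᵥ v)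
      = fun X i => v ⬝ᵥ X i := by
    ext X i
    rw [Matrix.mulVec, dotProduct_comm]; rfl
  have : ∀ i : Fin n, SigmaFinite ((fun _ : Fin n =>
      (Measure.pi (fun _ : Fin p => gaussianReal 0 1))) i |>.map (fun x => v ⬝ᵥ x)) := by
    intro i; simp only [h1]; infer_instance
  rw [h2, gaussianDesign, Measure.pi_map_pi (f := fun _ x => v ⬝ᵥ x)
    (fun _ => hm.aemeasurable), noiseLaw_one]
  simp only [h1]

theorem map_col_gaussianDesign (j : Fin p) :
    (gaussianDesign n p).map (fun X i => X i j) = noiseLaw n 1 := by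
  rw [← map_mulVec_gaussianDesign (n := n) (v := Pi.single j 1) (by simp [Pi.single_apply])]
  congr 1
  ext X i
  simp

/-! ### The matrix `(I + (τ₁² / σ²) X_z X_zᵀ)⁻¹` -/

theorem dotProduct_self_eq_sum_sq {ι : Type*} [Fintype ι] (a : ι → ℝ) :
    a ⬝ᵥ a = ∑ i, a i ^ 2 := by
  simp [dotProduct, sq]

theorem dotProduct_self_nonneg_real {ι : Type*} [Fintype ι] (a : ι → ℝ) : 0 ≤ a ⬝ᵥ a := by
  rw [dotProduct_self_eq_sum_sq]; positivity

/-- The defining equation of `A_z⁻¹ w`, valid because `A_z` is positive definite. It also shows that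
`w - A_z⁻¹ w` lies in the span of the columns in `z`. -/
theorem add_smul_modelInv_mulVec (σ τ₁ : ℝ) (X : Matrix (Fin n) (Fin p) ℝ)
    (z : Finset (Fin p)) (w : Fin n → ℝ) :
    modelInv σ τ₁ X z *ᵥ w
      + (τ₁ ^ 2 / σ ^ 2) • (subDesign X z *ᵥ ((subDesign X z)ᵀ *ᵥ (modelInv σ τ₁ X z *ᵥ w)))
      = w := by
  have hpsd : (subDesign X z * (subDesign X z)ᵀ).PosSemidef := by
    have := Matrix.posSemidef_self_mul_conjTranspose (subDesign X z)
    rwa [Matrix.conjTranspose_eq_transpose_of_trivial] at this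
  have hpd : (1 + (τ₁ ^ 2 / σ ^ 2) • (subDesign X z * (subDesign X z)ᵀ)).PosDef :=
    Matrix.PosDef.one.add_posSemidef (hpsd.smul (by positivity))
  have h := Matrix.mul_nonsing_inv _ ((Matrix.isUnit_iff_isUnit_det _).1 hpd.isUnit)
  have h2 := congrArg (fun M => M *ᵥ w) h
  simp only [one_mulVec, ← mulVec_mulVec] at h2
  rw [add_mulVec, one_mulVec, smul_mulVec, ← mulVec_mulVec] at h2
  exact h2

/-- Pairing the defining equation with `x = A_z⁻¹ w` leaves the excess `(τ₁² / σ²) ‖X_zᵀ x‖² ≥ 0`.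
-/
theorem dotProduct_modelInv_mulVec_ge (σ τ₁ : ℝ) (X : Matrix (Fin n) (Fin p) ℝ)
    (z : Finset (Fin p)) (w : Fin n → ℝ) :
    (modelInv σ τ₁ X z *ᵥ w) ⬝ᵥ (modelInv σ τ₁ X z *ᵥ w) ≤ w ⬝ᵥ (modelInv σ τ₁ X z *ᵥ w) := by
  have h := add_smul_modelInv_mulVec σ τ₁ X z w
  generalize modelInv σ τ₁ X z *ᵥ w = x at h ⊢
  conv_rhs => rw [← h]
  rw [add_dotProduct, smul_dotProduct, dotProduct_comm (subDesign X z *ᵥ _) x,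
    dotProduct_mulVec x, ← mulVec_transpose]
  have := dotProduct_self_nonneg_real ((subDesign X z)ᵀ *ᵥ x)
  have h2 : 0 ≤ τ₁ ^ 2 / σ ^ 2 := by positivity
  have := mul_nonneg h2 this
  simp only [smul_eq_mul]
  linarith

/-- Contraction: `0 ≤ ‖w - x‖²` and `‖x‖² ≤ ⟨w, x⟩` give `‖w‖² ≥ 2⟨w, x⟩ - ‖x‖² ≥ ‖x‖²`. -/
theorem sum_sq_modelInv_mulVec_le (σ τ₁ : ℝ) (X : Matrix (Fin n) (Fin p) ℝ)
    (z : Finset (Fin p)) (w : Fin n → ℝ) :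
    ∑ i, (modelInv σ τ₁ X z *ᵥ w) i ^ 2 ≤ ∑ i, w i ^ 2 := by
  have h := dotProduct_modelInv_mulVec_ge σ τ₁ X z w
  set x := modelInv σ τ₁ X z *ᵥ w
  rw [← dotProduct_self_eq_sum_sq, ← dotProduct_self_eq_sum_sq]
  have h2 := dotProduct_self_nonneg_real (w - x)
  rw [sub_dotProduct, dotProduct_sub, dotProduct_sub, dotProduct_comm x w] at h2
  linarith

theorem measurable_matrix_inv_apply {Ω ι : Type*} [MeasurableSpace Ω] [Fintype ι] [DecidableEq ι]
    {M : Ω → Matrix ι ι ℝ} (hM : ∀ i j, Measurable fun ω => M ω i j) (i j : ι) :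
    Measurable fun ω => (M ω)⁻¹ i j := by
  have hdet : ∀ {N : Ω → Matrix ι ι ℝ}, (∀ i j, Measurable fun ω => N ω i j) →
      Measurable fun ω => (N ω).det := by
    intro N hN
    simp only [Matrix.det_apply]
    exact Finset.measurable_fun_sum _ fun τ _ =>
      (Finset.measurable_fun_prod _ fun i _ => hN _ _).const_smul _
  simp only [Matrix.inv_def, Matrix.smul_apply, smul_eq_mul, Ring.inverse_eq_inv',
    Matrix.adjugate_apply]
  refine (hdet hM).inv.mul (hdet fun a b => ?_)
  simp only [Matrix.updateRow_apply]
  split_ifs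
  · exact measurable_const
  · exact hM _ _

theorem measurable_modelInv_apply (σ τ₁ : ℝ) (z : Finset (Fin p)) (i j : Fin n) :
    Measurable fun X : Fin n → Fin p → ℝ => modelInv σ τ₁ (Matrix.of X) z i j := by
  refine measurable_matrix_inv_apply (fun a b => ?_) i j
  simp only [Matrix.add_apply, Matrix.smul_apply, Matrix.mul_apply, subDesign,
    Matrix.submatrix_apply, Matrix.transpose_apply, Matrix.of_apply]
  fun_prop

theorem measurable_modelInv_dotProduct (σ τ₁ : ℝ) (z : Finset (Fin p)) (j : Fin p) :
    Measurable fun ω : (Fin n → Fin p → ℝ) × (Fin n → ℝ) =>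
      (modelInv σ τ₁ (Matrix.of ω.1) z *ᵥ (fun i => (Matrix.of ω.1) i j)) ⬝ᵥ ω.2 := by
  have : ∀ a b, Measurable fun ω : (Fin n → Fin p → ℝ) × (Fin n → ℝ) =>
      modelInv σ τ₁ (Matrix.of ω.1) z a b :=
    fun a b => (measurable_modelInv_apply σ τ₁ z a b).comp measurable_fst
  simp only [dotProduct, mulVec, Matrix.of_apply]
  fun_prop

/-! ### Union bounds -/

/-- The number of models with at most `m` columns. -/
theorem card_filter_card_le (hp : 2 ≤ p) (m : ℕ) :
    (Finset.univ.filter fun z : Finset (Fin p) => z.card ≤ m).card ≤ 2 * p ^ m := by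
  have h1 : (Finset.univ.filter fun z : Finset (Fin p) => z.card ≤ m)
      ⊆ (Finset.range (m + 1)).biUnion fun r => Finset.powersetCard r Finset.univ := by
    intro z hz
    simp only [Finset.mem_filter, Finset.mem_univ, true_and] at hz
    simp only [Finset.mem_biUnion, Finset.mem_range, Finset.mem_powersetCard]
    exact ⟨z.card, by omega, Finset.subset_univ _, rfl⟩
  have h2 : ∀ m : ℕ, ∑ r ∈ Finset.range (m + 1), p ^ r ≤ 2 * p ^ m := by
    intro m
    induction m with
    | zero => simp
    | succ m ih =>
      rw [Finset.sum_range_succ, pow_succ]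
      nlinarith [Nat.zero_le (p ^ m)]
  refine (Finset.card_le_card h1).trans (Finset.card_biUnion_le.trans (le_trans ?_ (h2 m)))
  refine Finset.sum_le_sum fun r _ => ?_
  rw [Finset.card_powersetCard, Finset.card_univ, Fintype.card_fin]
  exact Nat.choose_le_pow p r

/-- The number of models that extend `zstar` by at most `s` columns. -/
theorem card_filter_extension_le (hp : 2 ≤ p) (zstar : Finset (Fin p)) {s : ℝ} (hs : 0 ≤ s) :
    ((Finset.univ.filter fun z : Finset (Fin p) =>
      zstar ⊆ z ∧ (z.card : ℝ) ≤ (zstar.card : ℝ) + s).card : ℝ) ≤ 2 * (p : ℝ) ^ s := by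
  classical
  have hp1 : (1 : ℝ) ≤ p := by exact_mod_cast (by omega : 1 ≤ p)
  have h1 : (Finset.univ.filter fun z : Finset (Fin p) =>
      zstar ⊆ z ∧ (z.card : ℝ) ≤ (zstar.card : ℝ) + s).card
      ≤ (Finset.univ.filter fun z : Finset (Fin p) => z.card ≤ ⌊s⌋₊).card := by
    refine Finset.card_le_card_of_injOn (fun z => z \ zstar) ?_ ?_
    · intro z hz
      simp only [Finset.coe_filter, Finset.mem_univ, true_and, Set.mem_ofPred_eq] at hz ⊢
      rw [Finset.card_sdiff_of_subset hz.1]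
      apply Nat.le_floor
      rw [Nat.cast_sub (Finset.card_le_card hz.1)]
      linarith [hz.2]
    · intro z hz z' hz' h
      simp only [Finset.coe_filter, Finset.mem_univ, true_and, Set.mem_ofPred_eq] at hz hz'
      rw [← Finset.sdiff_union_of_subset hz.1, ← Finset.sdiff_union_of_subset hz'.1]
      exact congrArg (· ∪ zstar) h
  calc _ ≤ ((2 * p ^ ⌊s⌋₊ : ℕ) : ℝ) := by exact_mod_cast h1.trans (card_filter_card_le hp _)
    _ = 2 * (p : ℝ) ^ (⌊s⌋₊ : ℝ) := by push_cast; rw [Real.rpow_natCast]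
    _ ≤ _ := by gcongr; exact Nat.floor_le hs

theorem measure_biUnion_le_card_mul {Ω ι : Type*} [MeasurableSpace Ω] (μ : Measure Ω)
    (I : Finset ι) {S : ι → Set Ω} {N q : ℝ} (hI : (I.card : ℝ) ≤ N) (hq : 0 ≤ q)
    (h : ∀ i ∈ I, μ (S i) ≤ ENNReal.ofReal q) :
    μ (⋃ i ∈ I, S i) ≤ ENNReal.ofReal (N * q) := by
  refine (measure_biUnion_finset_le I S).trans ((Finset.sum_le_sum h).trans ?_)
  rw [Finset.sum_const, nsmul_eq_mul, ← ENNReal.ofReal_natCast, ← ENNReal.ofReal_mul (by positivity)]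
  exact ENNReal.ofReal_le_ofReal (by gcongr)

/-- The probability space is left abstract so that the same count of pairs `(z, j)` serves both the
noise law alone and the joint law of design and noise. -/
theorem measure_not_noiseBound_le {Ω : Type*} [MeasurableSpace Ω] (μ : Measure Ω) (hp : 2 ≤ p)
    (σ τ₁ : ℝ) {s : ℝ} (hs : 0 ≤ s) (zstar : Finset (Fin p)) (B : ℝ)
    (X : Ω → Matrix (Fin n) (Fin p) ℝ) (ε : Ω → Fin n → ℝ) {q : ℝ} (hq : 0 ≤ q)
    (h : ∀ z j, j ∉ z →
      μ {ω | B < |(modelInv σ τ₁ (X ω) z *ᵥ (fun i => X ω i j)) ⬝ᵥ ε ω|} ≤ ENNReal.ofReal q) :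
    μ {ω | ¬ NoiseBound σ τ₁ s zstar B (X ω) (ε ω)}
      ≤ ENNReal.ofReal (2 * (p : ℝ) ^ (s + 1) * q) := by
  classical
  set I := (Finset.univ.filter fun z : Finset (Fin p) =>
      zstar ⊆ z ∧ (z.card : ℝ) ≤ (zstar.card : ℝ) + s)
  set J := (I ×ˢ (Finset.univ : Finset (Fin p))).filter fun x => x.2 ∉ x.1
  have hp0 : (0 : ℝ) < p := by exact_mod_cast (by omega : 0 < p)
  have hJ : (J.card : ℝ) ≤ 2 * (p : ℝ) ^ (s + 1) := by
    have h1 : J.card ≤ I.card * p := by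
      refine (Finset.card_filter_le _ _).trans (le_of_eq ?_)
      rw [Finset.card_product, Finset.card_univ, Fintype.card_fin]
    calc (J.card : ℝ) ≤ (I.card : ℝ) * p := by exact_mod_cast h1
      _ ≤ (2 * (p : ℝ) ^ s) * p := by gcongr; exact card_filter_extension_le hp zstar hs
      _ = _ := by rw [Real.rpow_add hp0, Real.rpow_one]; ring
  refine (measure_mono ?_).trans (measure_biUnion_le_card_mul μ J (S := fun x =>
    {ω | B < |(modelInv σ τ₁ (X ω) x.1 *ᵥ (fun i => X ω i x.2)) ⬝ᵥ ε ω|}) hJ hq ?_)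
  · intro ω hω
    simp only [Set.mem_ofPred_eq, NoiseBound] at hω
    push Not at hω
    obtain ⟨z, hz, hc, j, hj, hB⟩ := hω
    simp only [Set.mem_iUnion]
    exact ⟨(z, j), by simp [J, I, hz, hc, hj], hB⟩
  · intro x hx
    exact h x.1 x.2 (Finset.mem_filter.1 hx).2

/-- Fubini, with sections over `G` bounded by `1`. Passing to `toMeasurable` allows an exceptional
set `G` that is not known to be measurable. -/
theorem measure_prod_le_add {α β : Type*} [MeasurableSpace α] [MeasurableSpace β]
    (μ : Measure α) (ν : Measure β) [IsProbabilityMeasure μ] [IsProbabilityMeasure ν]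
    {S : Set (α × β)} (hS : MeasurableSet S) (G : Set α) {q : ENNReal}
    (h : ∀ x ∉ G, ν (Prod.mk x ⁻¹' S) ≤ q) :
    (μ.prod ν) S ≤ μ G + q := by
  rw [Measure.prod_apply hS]
  calc ∫⁻ x, ν (Prod.mk x ⁻¹' S) ∂μ
      ≤ ∫⁻ x, ((toMeasurable μ G).indicator 1 x + q) ∂μ := by
        refine lintegral_mono fun x => ?_
        by_cases hx : x ∈ toMeasurable μ G
        · simp only [Set.indicator_of_mem hx, Pi.one_apply]
          exact prob_le_one.trans le_self_add
        · exact (h x fun hG => hx (subset_toMeasurable μ G hG)).trans le_add_self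
    _ = μ G + q := by
        rw [lintegral_add_right _ measurable_const, lintegral_indicator_one
          (measurableSet_toMeasurable μ G), measure_toMeasurable]
        simp

/-! ### The noise condition -/

/-- This cancellation fixes the constant in `B_s`: only the factor `1 / t` of Mills' bound survives,
whence the rate `1 / √(log p)`. -/
theorem rpow_mul_exp_neg_sq {s t : ℝ} (hp : 2 ≤ p)
    (ht : t ^ 2 = 2 * (s + 1) * Real.log p) :
    (p : ℝ) ^ (s + 1) * Real.exp (-t ^ 2 / 2) = 1 := by
  have hp0 : (0 : ℝ) < p := by exact_mod_cast (by omega : 0 < p)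
  rw [Real.rpow_def_of_pos hp0, ← Real.exp_add, ht]
  rw [Real.exp_eq_one_iff]; ring

theorem log_natCast_pos (hp : 2 ≤ p) : 0 < Real.log p :=
  Real.log_pos (by exact_mod_cast (by omega : 1 < p))

theorem noiseLaw_not_noiseBound_le (hp : 2 ≤ p) {σ τ₁ s : ℝ} (hσ : 0 < σ) (hs : 0 ≤ s)
    (X : Matrix (Fin n) (Fin p) ℝ) {V : ℝ} (hX : ∀ j, ∑ i, X i j ^ 2 ≤ V)
    (zstar : Finset (Fin p)) :
    noiseLaw n σ {ε | ¬ NoiseBound σ τ₁ s zstar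
        (√(2 * (s + 1) * Real.log p) * (σ * √V)) X ε}
      ≤ ENNReal.ofReal (2 / √(Real.log p)) := by
  have hL := log_natCast_pos hp
  set t := √(2 * (s + 1) * Real.log p) with htdef
  have ht : 0 < t := Real.sqrt_pos.2 (by positivity)
  have ht2 : t ^ 2 = 2 * (s + 1) * Real.log p := Real.sq_sqrt (by positivity)
  refine (measure_not_noiseBound_le (noiseLaw n σ) hp σ τ₁ hs zstar _ (fun _ => X) id
    (q := Real.exp (-t ^ 2 / 2) / t) (by positivity) ?_).trans ?_
  · intro z j _
    exact noiseLaw_tail_le hσ _ ((sum_sq_modelInv_mulVec_le σ τ₁ X z _).trans (hX j)) ht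
  · apply ENNReal.ofReal_le_ofReal
    have h1 := rpow_mul_exp_neg_sq (s := s) hp ht2
    have h2 : √(Real.log p) ≤ t := Real.sqrt_le_sqrt (by nlinarith)
    calc 2 * (p : ℝ) ^ (s + 1) * (Real.exp (-t ^ 2 / 2) / t)
        = 2 * ((p : ℝ) ^ (s + 1) * Real.exp (-t ^ 2 / 2)) / t := by ring
      _ = 2 / t := by rw [h1, mul_one]
      _ ≤ _ := div_le_div_of_nonneg_left zero_le_two (Real.sqrt_pos.2 hL) h2

/-- A factor `b` in the noise level is traded for the weaker bound `b² n` on the squared column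
norms. -/
theorem noise_level_eq (hp : 2 ≤ p) {σ s b : ℝ} (hs : 0 ≤ s) (hb : 0 ≤ b) :
    b * (σ * √(2 * (s + 1) * n * Real.log p))
      = √(2 * (s + 1) * Real.log p) * (σ * √(b ^ 2 * n)) := by
  have hL := log_natCast_pos hp
  rw [Real.sqrt_mul (sq_nonneg b), Real.sqrt_sq hb,
    show 2 * (s + 1) * n * Real.log p = 2 * (s + 1) * Real.log p * n by ring,
    Real.sqrt_mul (show 0 ≤ 2 * (s + 1) * Real.log p by positivity)]
  ring

theorem noise_condition_fixed_design :
    ∃ C : ℝ, ∀ (n p : ℕ), 2 ≤ p → ∀ (σ τ₁ s : ℝ), 0 < σ → 0 < τ₁ → 0 ≤ s →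
      ∀ X : Matrix (Fin n) (Fin p) ℝ, (∀ j, ∑ i, X i j ^ 2 ≤ (n : ℝ)) →
      ∀ zstar : Finset (Fin p),
        noiseLaw n σ {ε | ¬ NoiseBound σ τ₁ s zstar
          (σ * √(2 * (s + 1) * n * Real.log p)) X ε}
          ≤ ENNReal.ofReal (C / √(Real.log p)) := by
  refine ⟨2, fun n p hp σ τ₁ s hσ _ hs X hX zstar => ?_⟩
  have h := noise_level_eq (n := n) (σ := σ) hp hs zero_le_one
  rw [one_mul, one_pow, one_mul] at h
  rw [h]
  exact noiseLaw_not_noiseBound_le hp hσ hs X hX zstar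

/-- With high probability all columns of a Gaussian design have squared norm below `r`. -/
theorem gaussianDesign_exists_col_ge (n p : ℕ) {l r : ℝ} (h0 : 0 ≤ l) (h1 : l ≤ 1 / 4) :
    gaussianDesign n p {X | ∃ j, r ≤ ∑ i, X i j ^ 2}
      ≤ ENNReal.ofReal (p * Real.exp (2 * n * l ^ 2 - l * (r - n))) := by
  have hset : {X : Fin n → Fin p → ℝ | ∃ j, r ≤ ∑ i, X i j ^ 2}
      = ⋃ j ∈ Finset.univ, {X | r ≤ ∑ i, X i j ^ 2} := by ext; simp
  rw [hset]
  refine measure_biUnion_le_card_mul _ _ (by simp) (by positivity) fun j _ => ?_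
  refine le_trans (le_of_eq ?_) (chiSq_upper_tail n h0 h1)
  rw [← map_col_gaussianDesign j, Measure.map_apply (by fun_prop)
    (measurableSet_le measurable_const (by fun_prop))]
  rfl

theorem mul_exp_neg_two_log (hp : 2 ≤ p) : (p : ℝ) * Real.exp (-(2 * Real.log p)) = 1 / p := by
  have hp0 : (0 : ℝ) < p := by exact_mod_cast (by omega : 0 < p)
  rw [Real.exp_neg, two_mul, Real.exp_add, Real.exp_log hp0]
  field_simp

theorem measurableSet_not_noiseBound (σ τ₁ s : ℝ) (zstar : Finset (Fin p)) (B : ℝ) :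
    MeasurableSet {ω : (Fin n → Fin p → ℝ) × (Fin n → ℝ) |
      ¬ NoiseBound σ τ₁ s zstar B (Matrix.of ω.1) ω.2} := by
  have hset : {ω : (Fin n → Fin p → ℝ) × (Fin n → ℝ) |
      ¬ NoiseBound σ τ₁ s zstar B (Matrix.of ω.1) ω.2}
      = ⋃ (z : Finset (Fin p)) (j : Fin p) (_ : zstar ⊆ z ∧
          (z.card : ℝ) ≤ (zstar.card : ℝ) + s ∧ j ∉ z),
        {ω | B < |(modelInv σ τ₁ (Matrix.of ω.1) z *ᵥ (fun i => (Matrix.of ω.1) i j))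
          ⬝ᵥ ω.2|} := by
    ext ω
    simp only [NoiseBound, Set.mem_ofPred_eq, Set.mem_iUnion]
    push Not
    constructor
    · rintro ⟨z, h1, h2, j, h3, h4⟩; exact ⟨z, j, ⟨h1, h2, h3⟩, h4⟩
    · rintro ⟨z, j, ⟨h1, h2, h3⟩, h4⟩; exact ⟨z, h1, h2, j, h3, h4⟩
  rw [hset]
  refine MeasurableSet.iUnion fun z => MeasurableSet.iUnion fun j => MeasurableSet.iUnion fun _ => ?_
  exact measurableSet_lt measurable_const
    (measurable_norm.comp (measurable_modelInv_dotProduct σ τ₁ z j))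

theorem noise_condition_gaussian_design :
    ∀ η : ℝ, 0 < η → ∃ C₀ C : ℝ, 0 < C₀ ∧ ∀ (n p : ℕ), 2 ≤ p → C₀ * Real.log p ≤ n →
      ∀ (σ τ₁ s : ℝ), 0 < σ → 0 < τ₁ → 0 ≤ s → ∀ zstar : Finset (Fin p),
        ((gaussianDesign n p).prod (noiseLaw n σ))
          {ω | ¬ NoiseBound σ τ₁ s zstar
            ((1 + η) * (σ * √(2 * (s + 1) * n * Real.log p))) (Matrix.of ω.1) ω.2}
          ≤ ENNReal.ofReal (C / √(Real.log p)) := by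
  intro η hη
  -- `l ≤ 1/4` is required by the chi-square moments, and `4l ≤ η` lets the linear gain absorb
  -- `2nl²`, leaving an exponent below `-lηn`. With `C₀ = 2 / (lη)` this is at most `-2 log p`,
  -- which beats the `p` columns. The constant `3` is `2` for the noise plus `1` for the columns.
  set l := min η 1 / 4 with hl
  have hl0 : 0 < l := by positivity
  have hl1 : l ≤ 1 / 4 := by have := min_le_right η 1; linarith
  have hl2 : 4 * l ≤ η := by have := min_le_left η 1; linarith
  refine ⟨2 / (l * η), 3, by positivity, fun n p hp hn σ τ₁ s hσ _ hs zstar => ?_⟩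
  have hL := log_natCast_pos hp
  have hp0 : (0 : ℝ) < p := by exact_mod_cast (by omega : 0 < p)
  rw [noise_level_eq hp hs (by positivity)]
  refine (measure_prod_le_add _ _ (measurableSet_not_noiseBound _ _ _ _ _)
    {X | ∃ j, (1 + η) ^ 2 * n ≤ ∑ i, X i j ^ 2}
    (q := ENNReal.ofReal (2 / √(Real.log p))) ?_).trans ?_
  · intro X hX
    simp only [Set.mem_ofPred_eq, not_exists, not_le] at hX
    exact noiseLaw_not_noiseBound_le hp hσ hs (Matrix.of X) (fun j => (hX j).le) zstar
  · refine (add_le_add_left (gaussianDesign_exists_col_ge n p hl0.le hl1) _).trans ?_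
    rw [← ENNReal.ofReal_add (by positivity) (by positivity)]
    apply ENNReal.ofReal_le_ofReal
    have h1 : 2 * n * l ^ 2 - l * ((1 + η) ^ 2 * n - n) ≤ -(2 * Real.log p) := by
      have h2 : 2 * Real.log p ≤ l * η * n := by
        rw [div_mul_eq_mul_div, div_le_iff₀ (by positivity)] at hn
        linarith
      have hn0 : (0 : ℝ) ≤ n := by positivity
      have h3 : 0 ≤ l * n := by positivity
      nlinarith [mul_nonneg h3 hη.le, mul_nonneg h3 (sub_nonneg.2 hl2),
        mul_nonneg h3 (sq_nonneg η)]
    have h4 : (p : ℝ) * Real.exp (2 * n * l ^ 2 - l * ((1 + η) ^ 2 * n - n)) ≤ 1 / p := by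
      rw [← mul_exp_neg_two_log hp]
      gcongr
    have h5 : 1 / (p : ℝ) ≤ 1 / √(Real.log p) := by
      apply one_div_le_one_div_of_le (Real.sqrt_pos.2 hL)
      rw [Real.sqrt_le_left hp0.le]
      have h6 := Real.log_le_self hp0.le
      have h7 : (1 : ℝ) ≤ p := by exact_mod_cast (by omega : 1 ≤ p)
      nlinarith
    have h8 : 3 / √(Real.log p) = 1 / √(Real.log p) + 2 / √(Real.log p) := by ring
    rw [h8]
    linarith

theorem lintegral_exp_col_gaussianDesign_le (j : Fin p) {l : ℝ} (h1 : l ≤ 1 / 4) :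
    ∫⁻ X, ENNReal.ofReal (Real.exp (l * (∑ i, X i j ^ 2 - n))) ∂(gaussianDesign n p)
      ≤ ENNReal.ofReal (Real.exp (2 * n * l ^ 2)) := by
  refine le_trans (le_of_eq ?_) (lintegral_exp_chiSq_le n h1)
  rw [← map_col_gaussianDesign j, lintegral_map (by fun_prop) (by fun_prop)]

/-- For a column of squared norm `q n` the threshold sits at `t / √q` standard deviations. The
bounds `1/q ≥ 2 - q` and `√q ≤ exp((q - 1)/2)` make the tail exponential in `q`, so it can be
integrated against the chi-square law. -/
theorem exp_tail_rescale_le {t q : ℝ} (ht : 0 < t) (hq : 0 < q) :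
    Real.exp (-(t / √q) ^ 2 / 2) / (t / √q)
      ≤ Real.exp (-t ^ 2 / 2) / t * Real.exp ((t ^ 2 + 1) / 2 * (q - 1)) := by
  have hsq : √q ≤ Real.exp ((q - 1) / 2) := by
    rw [Real.sqrt_le_left (Real.exp_pos _).le, ← Real.exp_nat_mul]
    have := Real.add_one_le_exp (q - 1)
    refine (by linarith : q ≤ Real.exp (q - 1)).trans (le_of_eq ?_)
    congr 1; push_cast; ring
  have hinv : 2 - q ≤ 1 / q := by
    rw [le_div_iff₀ hq]; nlinarith [sq_nonneg (q - 1)]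
  have hexp : Real.exp (-(t / √q) ^ 2 / 2)
      ≤ Real.exp (-t ^ 2 / 2 + t ^ 2 / 2 * (q - 1)) := by
    apply Real.exp_le_exp.2
    rw [div_pow, Real.sq_sqrt hq.le]
    have : t ^ 2 / q = t ^ 2 * (1 / q) := by ring
    rw [this]
    nlinarith [mul_le_mul_of_nonneg_left hinv (sq_nonneg t)]
  calc Real.exp (-(t / √q) ^ 2 / 2) / (t / √q)
      = Real.exp (-(t / √q) ^ 2 / 2) * √q / t := by field_simp
    _ ≤ Real.exp (-t ^ 2 / 2 + t ^ 2 / 2 * (q - 1)) * Real.exp ((q - 1) / 2) / t := by gcongr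
    _ = _ := by
      rw [← Real.exp_add, div_mul_eq_mul_div (Real.exp (-t ^ 2 / 2)), ← Real.exp_add]
      congr 2; ring

/-- The tail of one noise term, averaged over the Gaussian column, with the sharp exponent. -/
theorem gaussianDesign_prod_tail_le {σ τ₁ t : ℝ} (hσ : 0 < σ) (ht : 0 < t) (hn : 0 < n)
    (hl : (t ^ 2 + 1) / (2 * n) ≤ 1 / 4) (z : Finset (Fin p)) (j : Fin p) :
    ((gaussianDesign n p).prod (noiseLaw n σ))
      {ω | t * (σ * √n) < |(modelInv σ τ₁ (Matrix.of ω.1) z *ᵥ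
        (fun i => (Matrix.of ω.1) i j)) ⬝ᵥ ω.2|}
      ≤ ENNReal.ofReal (Real.exp (-t ^ 2 / 2) / t * Real.exp ((t ^ 2 + 1) ^ 2 / (2 * n))) := by
  have hn0 : (0 : ℝ) < n := by exact_mod_cast hn
  have hms : MeasurableSet {ω : (Fin n → Fin p → ℝ) × (Fin n → ℝ) |
      t * (σ * √n) < |(modelInv σ τ₁ (Matrix.of ω.1) z *ᵥ
        (fun i => (Matrix.of ω.1) i j)) ⬝ᵥ ω.2|} := measurableSet_lt measurable_const
    (measurable_norm.comp (measurable_modelInv_dotProduct σ τ₁ z j))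
  rw [Measure.prod_apply hms]
  calc _ ≤ ∫⁻ X, ENNReal.ofReal (Real.exp (-t ^ 2 / 2) / t) * ENNReal.ofReal
        (Real.exp ((t ^ 2 + 1) / (2 * n) * (∑ i, X i j ^ 2 - n))) ∂(gaussianDesign n p) := by
        refine lintegral_mono fun X => ?_
        set Q := ∑ i, X i j ^ 2 with hQ
        have hle := sum_sq_modelInv_mulVec_le σ τ₁ (Matrix.of X) z (fun i => X i j)
        have hQ0 : 0 ≤ Q := Finset.sum_nonneg fun i _ => sq_nonneg _
        -- Rescaling divides by the column norm. A zero column gives a zero linear form, for which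
        -- the strict inequality fails.
        rcases hQ0.eq_or_lt with h0 | hpos
        · have hzero : ∀ i, (modelInv σ τ₁ (Matrix.of X) z *ᵥ (fun i => X i j)) i = 0 := by
            intro i
            have h2 := Finset.single_le_sum (fun i _ => sq_nonneg
              ((modelInv σ τ₁ (Matrix.of X) z *ᵥ (fun i => X i j)) i)) (Finset.mem_univ i)
            have h3 := h2.trans (hle.trans h0.symm.le)
            exact pow_eq_zero_iff two_ne_zero |>.1 (le_antisymm h3 (sq_nonneg _))
          refine le_trans (le_of_eq ?_) zero_le
          convert measure_empty (μ := noiseLaw n σ)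
          ext ε
          simp only [Set.mem_preimage, Set.mem_ofPred_eq, Set.mem_empty_iff_false, iff_false, not_lt]
          have : (modelInv σ τ₁ (Matrix.of X) z *ᵥ fun i => (Matrix.of X) i j) = 0 :=
            funext hzero
          rw [this, zero_dotProduct, abs_zero]
          positivity
        · have hq : 0 < Q / n := by positivity
          have hthr : t * (σ * √n) = t / √(Q / n) * (σ * √Q) := by
            have h1 : √Q = √(Q / n) * √n := by
              rw [← Real.sqrt_mul hq.le, div_mul_cancel₀ _ hn0.ne']
            have h2 : √(Q / n) ≠ 0 := (Real.sqrt_pos.2 hq).ne'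
            rw [h1]; field_simp
          rw [← ENNReal.ofReal_mul (by positivity)]
          refine le_trans ?_ (ENNReal.ofReal_le_ofReal (le_of_le_of_eq
            (exp_tail_rescale_le ht hq) ?_))
          · rw [hthr]
            exact noiseLaw_tail_le hσ _ hle (by positivity)
          · congr 2; field_simp
    _ ≤ _ := by
        rw [lintegral_const_mul _ (by fun_prop), ENNReal.ofReal_mul (by positivity)]
        gcongr
        refine (lintegral_exp_col_gaussianDesign_le j hl).trans (le_of_eq ?_)
        congr 2; field_simp

theorem noise_condition_gaussian_design_exact :
    ∀ κ s η : ℝ, 0 < κ → 0 ≤ s → 0 < η → ∃ p₀ : ℕ, ∀ (n p : ℕ), p₀ ≤ p →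
      Real.log p ^ 2 ≤ κ * n → ∀ (σ τ₁ : ℝ), 0 < σ → 0 < τ₁ → ∀ zstar : Finset (Fin p),
        ((gaussianDesign n p).prod (noiseLaw n σ))
          {ω | ¬ NoiseBound σ τ₁ s zstar
            (σ * √(2 * (s + 1) * n * Real.log p)) (Matrix.of ω.1) ω.2}
          ≤ ENNReal.ofReal η := by
  intro κ s η hκ hs hη
  obtain ⟨K, hK⟩ : ∃ K, K = Real.exp ((2 * s + 3) ^ 2 * κ / 2) := ⟨_, rfl⟩
  have hK0 : 0 < K := hK ▸ Real.exp_pos _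
  -- The summands ensure in turn `t² + 1 ≤ (2s + 3) L`, the condition `l ≤ 1/4` of the averaged
  -- tail, and `2K / t ≤ η`. Here `K` bounds the averaging correction, through `L² ≤ κ n`.
  obtain ⟨L₀, hL₀⟩ : ∃ L₀, L₀ = 1 + 2 * (2 * s + 3) * κ + (2 * K / η) ^ 2 := ⟨_, rfl⟩
  have hL₀1 : 1 ≤ L₀ := by
    have : 0 ≤ 2 * (2 * s + 3) * κ + (2 * K / η) ^ 2 := by positivity
    linarith
  refine ⟨⌈Real.exp L₀⌉₊, fun n p hp hn σ τ₁ hσ _ zstar => ?_⟩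
  have hpe : Real.exp L₀ ≤ p := Nat.ceil_le.1 hp
  have hp0 : (0 : ℝ) < p := (Real.exp_pos _).trans_le hpe
  have hp2 : 2 ≤ p := by
    have h1 := Real.add_one_le_exp L₀
    have : (2 : ℝ) ≤ p := by linarith
    exact_mod_cast this
  obtain ⟨L, hLdef⟩ : ∃ L, L = Real.log p := ⟨_, rfl⟩
  rw [← hLdef] at hn ⊢
  have hLL : L₀ ≤ L := hLdef ▸ (Real.le_log_iff_exp_le hp0).2 hpe
  have hL1 : 1 ≤ L := hL₀1.trans hLL
  have hL : 0 < L := by linarith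
  have hn0 : (0 : ℝ) < n := by
    have : 0 < κ * n := lt_of_lt_of_le (by positivity) hn
    exact (mul_pos_iff_of_pos_left hκ).1 this
  obtain ⟨t, htdef⟩ : ∃ t, t = √(2 * (s + 1) * L) := ⟨_, rfl⟩
  have ht : 0 < t := htdef ▸ Real.sqrt_pos.2 (by positivity)
  have ht2 : t ^ 2 = 2 * (s + 1) * L := htdef ▸ Real.sq_sqrt (by positivity)
  have ht3 : t ^ 2 + 1 ≤ (2 * s + 3) * L := by rw [ht2]; linarith
  have hl : (t ^ 2 + 1) / (2 * n) ≤ 1 / 4 := by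
    rw [div_le_iff₀ (by positivity)]
    have h1 : 2 * (2 * s + 3) * κ ≤ L := by
      have : 0 ≤ (2 * K / η) ^ 2 := sq_nonneg _
      linarith
    have h2 : κ * (2 * (2 * s + 3) * L) ≤ κ * n := by nlinarith
    have h3 := le_of_mul_le_mul_left h2 hκ
    linarith
  have hexp : Real.exp ((t ^ 2 + 1) ^ 2 / (2 * n)) ≤ K := by
    rw [hK]
    apply Real.exp_le_exp.2
    rw [div_le_iff₀ (by positivity)]
    have h1 : (t ^ 2 + 1) ^ 2 ≤ ((2 * s + 3) * L) ^ 2 := by gcongr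
    nlinarith [mul_le_mul_of_nonneg_left hn (sq_nonneg (2 * s + 3))]
  have hthr : σ * √(2 * (s + 1) * n * L) = t * (σ * √n) := by
    have h := noise_level_eq (n := n) (σ := σ) hp2 hs zero_le_one
    rwa [one_mul, one_pow, one_mul, ← hLdef, ← htdef] at h
  rw [hthr]
  have hnpos : 0 < n := by exact_mod_cast hn0
  obtain ⟨q, hq⟩ : ∃ q, q = Real.exp (-t ^ 2 / 2) / t * Real.exp ((t ^ 2 + 1) ^ 2 / (2 * n)) :=
    ⟨_, rfl⟩
  have hq0 : 0 ≤ q := hq ▸ by positivity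
  have htail : ∀ (z : Finset (Fin p)) (j : Fin p), j ∉ z →
      ((gaussianDesign n p).prod (noiseLaw n σ))
        {ω | t * (σ * √n) < |(modelInv σ τ₁ (Matrix.of ω.1) z *ᵥ
          (fun i => (Matrix.of ω.1) i j)) ⬝ᵥ ω.2|} ≤ ENNReal.ofReal q := by
    intro z j _
    rw [hq]
    exact gaussianDesign_prod_tail_le hσ ht hnpos hl z j
  refine (measure_not_noiseBound_le ((gaussianDesign n p).prod (noiseLaw n σ)) hp2 σ τ₁ hs zstar
    (t * (σ * √n)) (fun ω => Matrix.of ω.1) (fun ω => ω.2) hq0 htail).trans ?_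
  rw [hq]
  apply ENNReal.ofReal_le_ofReal
  have h1 := rpow_mul_exp_neg_sq (s := s) hp2 (hLdef ▸ ht2)
  have h2 : 2 * K / η ≤ t := by
    rw [htdef]
    apply Real.le_sqrt_of_sq_le
    have : 0 ≤ 2 * (2 * s + 3) * κ := by positivity
    nlinarith
  calc 2 * (p : ℝ) ^ (s + 1) *
        (Real.exp (-t ^ 2 / 2) / t * Real.exp ((t ^ 2 + 1) ^ 2 / (2 * n)))
      = 2 * ((p : ℝ) ^ (s + 1) * Real.exp (-t ^ 2 / 2)) *
          Real.exp ((t ^ 2 + 1) ^ 2 / (2 * n)) / t := by ring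
    _ ≤ 2 * K / t := by rw [h1, mul_one]; gcongr
    _ ≤ η := by
      rw [div_le_iff₀ hη] at h2
      rw [div_le_iff₀ ht]; linarith

/-! ### Coherence -/

/-- With `x = A_z⁻¹ X_i`, expanding `‖X_j ± x‖² ≥ 0` gives `2|⟨X_j, x⟩| ≤ ‖X_j‖² + ‖x‖² ≤ 2V` by
contraction. The sign of `V` matters only for the empty set, whose `sSup` is `0`. -/
theorem coherence_le {σ τ₁ : ℝ} {X : Matrix (Fin n) (Fin p) ℝ} {k : ℕ} {V : ℝ} (hV : 0 ≤ V)
    (hX : ∀ j, ∑ i, X i j ^ 2 ≤ V) : coherence σ τ₁ X k ≤ V := by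
  refine Real.sSup_le ?_ hV
  rintro r ⟨z, j, i, -, -, -, rfl⟩
  have h1 := sum_sq_modelInv_mulVec_le σ τ₁ X z (fun l => X l i)
  generalize modelInv σ τ₁ X z *ᵥ (fun l => X l i) = x at h1 ⊢
  have h2 := dotProduct_self_nonneg_real ((fun l => X l j) - x)
  have h3 := dotProduct_self_nonneg_real ((fun l => X l j) + x)
  rw [sub_dotProduct, dotProduct_sub, dotProduct_sub, dotProduct_comm x (fun l => X l j),
    dotProduct_self_eq_sum_sq, dotProduct_self_eq_sum_sq] at h2
  rw [add_dotProduct, dotProduct_add, dotProduct_add, dotProduct_comm x (fun l => X l j),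
    dotProduct_self_eq_sum_sq, dotProduct_self_eq_sum_sq] at h3
  have h4 := hX i
  have h5 := hX j
  rw [abs_le]
  constructor <;> linarith

theorem coherence_gaussian_design :
    ∀ c₀ κ : ℝ, 0 < c₀ → 0 < κ → ∃ C C' : ℝ, ∀ (n p k : ℕ), 2 ≤ p → 1 ≤ k →
      c₀ * (k * Real.log p) ≤ n → (n : ℝ) ≤ κ * (k * Real.log p) →
      ∀ (σ τ₁ : ℝ), 0 < σ → 0 < τ₁ →
        gaussianDesign n p
          {X | ¬ coherence σ τ₁ (Matrix.of X) k ≤ C * ((k : ℝ) ^ 2 * Real.log p)}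
          ≤ ENNReal.ofReal (C' / p) := by
  intro c₀ κ hc₀ hκ
  -- At `l = 1/4` the chi-square exponent is `-5n/8 - 2n/c₀`, at most `-2 log p` since `n ≥ c₀ log
  -- p`.
  set M := 4 + 8 / c₀ with hM
  have hM0 : 0 < M := by positivity
  refine ⟨M * κ, 1, fun n p k hp hk hn1 hn2 σ τ₁ _ _ => ?_⟩
  have hL := log_natCast_pos hp
  have hk1 : (1 : ℝ) ≤ k := by exact_mod_cast hk
  refine (measure_mono (t := {X | ∃ j, M * n ≤ ∑ i, X i j ^ 2}) fun X hX => ?_).trans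
    ((gaussianDesign_exists_col_ge n p (l := 1 / 4) (by norm_num) le_rfl).trans ?_)
  · by_contra hcon
    simp only [Set.mem_ofPred_eq, not_exists, not_le] at hcon
    refine hX ((coherence_le (V := M * n) (by positivity) fun j => (hcon j).le).trans ?_)
    have h1 : (k : ℝ) * Real.log p ≤ k ^ 2 * Real.log p := by
      gcongr; nlinarith
    calc M * n ≤ M * (κ * (k * Real.log p)) := by gcongr
      _ ≤ M * (κ * (k ^ 2 * Real.log p)) := by gcongr
      _ = _ := by ring
  · apply ENNReal.ofReal_le_ofReal
    rw [← mul_exp_neg_two_log hp]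
    gcongr
    have h1 : Real.log p ≤ k * Real.log p := le_mul_of_one_le_left hL.le hk1
    have h2 : c₀ * Real.log p ≤ n := (mul_le_mul_of_nonneg_left h1 hc₀.le).trans hn1
    have h3 : Real.log p ≤ n / c₀ := by rw [le_div_iff₀ hc₀]; linarith
    have h4 : M * n = 4 * n + 8 * (n / c₀) := by rw [hM]; ring
    have hn0 : (0 : ℝ) ≤ n := by positivity
    rw [h4]
    linarith

/-! ### Nets of the sphere -/

/-- Volume packing: disjoint balls of radius `1/8` around the points lie in the ball of radius
`9/8`. -/
theorem card_le_of_quarter_separated {E : Type*} [NormedAddCommGroup E] [NormedSpace ℝ E]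
    [FiniteDimensional ℝ E] (s : Finset E) (hs : ∀ c ∈ s, ‖c‖ = 1)
    (h : ∀ c ∈ s, ∀ d ∈ s, c ≠ d → 1 / 4 ≤ ‖c - d‖) :
    s.card ≤ 9 ^ Module.finrank ℝ E := by
  borelize E
  let μ : Measure E := Measure.addHaar
  have hdisj : (s : Set E).Pairwise (Function.onFun Disjoint fun c => Metric.ball c (1 / 8)) := by
    rintro c hc d hd hcd
    apply Metric.ball_disjoint_ball
    rw [dist_eq_norm]
    linarith [h c hc d hd hcd]
  have hsub : (⋃ c ∈ s, Metric.ball c (1 / 8 : ℝ)) ⊆ Metric.ball (0 : E) (9 / 8) := by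
    refine Set.iUnion₂_subset fun x hx => Metric.ball_subset_ball' ?_
    rw [dist_zero_right, hs x hx]; norm_num
  have hvol : (s.card : ENNReal) * ENNReal.ofReal ((1 / 8) ^ Module.finrank ℝ E)
        * μ (Metric.ball 0 1)
      ≤ ENNReal.ofReal ((9 / 8) ^ Module.finrank ℝ E) * μ (Metric.ball 0 1) :=
    calc _ = μ (⋃ c ∈ s, Metric.ball c (1 / 8 : ℝ)) := by
          rw [measure_biUnion_finset hdisj fun c _ => measurableSet_ball]
          simp only [μ.addHaar_ball_of_pos _ (show (0 : ℝ) < 1 / 8 by norm_num),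
            Finset.sum_const, nsmul_eq_mul, mul_assoc]
      _ ≤ μ (Metric.ball (0 : E) (9 / 8)) := measure_mono hsub
      _ = _ := by rw [μ.addHaar_ball_of_pos _ (by norm_num)]
  have hcard := (ENNReal.mul_le_mul_iff_left (Metric.measure_ball_pos _ _ zero_lt_one).ne'
    measure_ball_lt_top.ne).1 hvol
  have hreal : (s.card : ℝ) ≤ (9 : ℝ) ^ Module.finrank ℝ E := by
    have := ENNReal.toReal_le_of_le_ofReal (by positivity) hcard
    rw [ENNReal.toReal_mul, ENNReal.toReal_ofReal (by positivity), ENNReal.toReal_natCast,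
      div_pow, div_pow, one_pow] at this
    have h8 : (0 : ℝ) < 8 ^ Module.finrank ℝ E := by positivity
    rw [mul_one_div, div_le_div_iff_of_pos_right h8] at this
    exact this
  exact_mod_cast hreal

/-- The unit sphere has a `1/4`-net with at most `9 ^ dim` points. -/
theorem exists_quarter_net (E : Type*) [NormedAddCommGroup E] [NormedSpace ℝ E]
    [FiniteDimensional ℝ E] :
    ∃ N : Finset E, (∀ u ∈ N, ‖u‖ = 1) ∧ N.card ≤ 9 ^ Module.finrank ℝ E ∧
      ∀ v : E, ‖v‖ = 1 → ∃ u ∈ N, ‖v - u‖ ≤ 1 / 4 := by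
  classical
  by_contra! hcon
  -- Without a small net, a separated set could always be enlarged by a point far from it,
  -- contradicting the packing bound.
  have key : ∀ m : ℕ, ∃ N : Finset E, N.card = m ∧ (∀ u ∈ N, ‖u‖ = 1) ∧
      ∀ c ∈ N, ∀ d ∈ N, c ≠ d → 1 / 4 ≤ ‖c - d‖ := by
    intro m
    induction m with
    | zero => exact ⟨∅, by simp⟩
    | succ m ih =>
      obtain ⟨N, hm, hu, hN⟩ := ih
      obtain ⟨v, hv, hfar⟩ := hcon N hu (card_le_of_quarter_separated N hu hN)
      have hvN : v ∉ N := fun h => by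
        have := hfar v h
        rw [sub_self, norm_zero] at this
        linarith
      refine ⟨insert v N, by rw [Finset.card_insert_of_notMem hvN, hm], ?_, ?_⟩
      · intro u hu'
        rcases Finset.mem_insert.1 hu' with rfl | h
        exacts [hv, hu u h]
      · intro c hc d hd hcd
        rcases Finset.mem_insert.1 hc with hcv | hc <;>
          rcases Finset.mem_insert.1 hd with hdv | hd
        · exact absurd (hcv.trans hdv.symm) hcd
        · rw [hcv]; exact (hfar d hd).le
        · rw [hdv, norm_sub_rev]; exact (hfar c hc).le
        · exact hN c hc d hd hcd
  obtain ⟨N, hm, hu, hN⟩ := key (9 ^ Module.finrank ℝ E + 1)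
  have := card_le_of_quarter_separated N hu hN
  omega

/-- A linear map with norms between `lo` and `hi` on a `1/4`-net is bounded below. -/
theorem norm_lower_bound_of_net {E F : Type*} [NormedAddCommGroup E] [NormedSpace ℝ E]
    [NormedAddCommGroup F] [NormedSpace ℝ F] (A : E →L[ℝ] F) {N : Finset E} {lo hi : ℝ}
    (hi0 : 0 ≤ hi) (hN : ∀ v : E, ‖v‖ = 1 → ∃ u ∈ N, ‖v - u‖ ≤ 1 / 4)
    (hA : ∀ u ∈ N, lo ≤ ‖A u‖ ∧ ‖A u‖ ≤ hi) (v : E) : (lo - hi / 3) * ‖v‖ ≤ ‖A v‖ := by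
  have hdiff : ∀ v u : E, ‖v - u‖ ≤ 1 / 4 → ‖A v - A u‖ ≤ ‖A‖ / 4 := by
    intro v u h
    rw [← map_sub]
    refine (A.le_opNorm _).trans ?_
    have := mul_le_mul_of_nonneg_left h (norm_nonneg A)
    linarith
  -- A self-bounding estimate: it gives `‖A‖ ≤ 4 hi / 3`, so moving to the net costs at most `hi /
  -- 3`.
  have hop : ‖A‖ ≤ hi + ‖A‖ / 4 := by
    refine ContinuousLinearMap.opNorm_le_of_unit_norm (by positivity) fun x hx => ?_
    obtain ⟨u, hu, hd⟩ := hN x hx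
    have h1 := norm_le_norm_add_norm_sub' (A x) (A u)
    linarith [hdiff x u hd, (hA u hu).2]
  have hunit : ∀ x : E, ‖x‖ = 1 → lo - hi / 3 ≤ ‖A x‖ := by
    intro x hx
    obtain ⟨u, hu, hd⟩ := hN x hx
    have h1 := norm_le_norm_add_norm_sub (A x) (A u)
    linarith [hdiff x u hd, (hA u hu).1]
  rcases eq_or_ne v 0 with rfl | hv
  · simp
  · have hv' : 0 < ‖v‖ := norm_pos_iff.2 hv
    have := hunit (‖v‖⁻¹ • v) (by rw [norm_smul, norm_inv, norm_norm, inv_mul_cancel₀ hv'.ne'])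
    rw [map_smul, norm_smul, norm_inv, norm_norm] at this
    rwa [← le_div_iff₀ hv', div_eq_inv_mul ‖A v‖]

/-! ### Sparse eigenvalues of a Gaussian design -/

theorem sum_coe_eq_sum {ι : Type*} [Fintype ι] (T : Finset ι) {f : ι → ℝ}
    (hf : ∀ j ∉ T, f j = 0) : ∑ j : T, f j = ∑ j, f j := by
  rw [Finset.sum_coe_sort T f]
  exact Finset.sum_subset (Finset.subset_univ T) fun j _ hj => hf j hj

/-- The extension by zero of a vector on the columns of a model. -/
def zeroExtend (T : Finset (Fin p)) (u : T → ℝ) : Fin p → ℝ :=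
  fun j => if h : j ∈ T then u ⟨j, h⟩ else 0

theorem zeroExtend_of_notMem {T : Finset (Fin p)} (u : T → ℝ) {j : Fin p} (hj : j ∉ T) :
    zeroExtend T u j = 0 := by simp [zeroExtend, hj]

@[simp] theorem zeroExtend_coe {T : Finset (Fin p)} (u : T → ℝ) (j : T) :
    zeroExtend T u j = u j := by simp [zeroExtend]

theorem zeroExtend_restrict {T : Finset (Fin p)} {v : Fin p → ℝ} (hv : ∀ j ∉ T, v j = 0) :
    zeroExtend T (fun j : T => v j) = v := by
  ext j
  by_cases h : j ∈ T
  · simp [zeroExtend, h]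
  · rw [zeroExtend_of_notMem _ h, hv j h]

theorem sum_sq_zeroExtend {T : Finset (Fin p)} (u : T → ℝ) :
    ∑ j, zeroExtend T u j ^ 2 = ∑ j, u j ^ 2 := by
  rw [← sum_coe_eq_sum T fun j hj => by rw [zeroExtend_of_notMem u hj]; norm_num]
  simp

theorem mulVec_zeroExtend (X : Matrix (Fin n) (Fin p) ℝ) (T : Finset (Fin p)) (u : T → ℝ) :
    X *ᵥ zeroExtend T u = subDesign X T *ᵥ u := by
  ext i
  simp only [mulVec, dotProduct]
  rw [← sum_coe_eq_sum T fun j hj => by rw [zeroExtend_of_notMem u hj, mul_zero]]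
  simp [subDesign]

/-- The squared singular values of all submatrices with at most `m` columns are at least
`c * n`. -/
def SparseLowerBound (c : ℝ) (m : ℕ) (X : Matrix (Fin n) (Fin p) ℝ) : Prop :=
  ∀ (T : Finset (Fin p)) (v : Fin p → ℝ), T.card ≤ m → (∀ j ∉ T, v j = 0) →
    c * n * ∑ j, v j ^ 2 ≤ ∑ i, (X *ᵥ v) i ^ 2

/-- On the net the norms lie between `3/4 √n` and `5/4 √n`; then `3/4 - 5/12 = 1/3`, whose square is
the constant `1/9`. -/
theorem sparseLowerBound_of_net {X : Matrix (Fin n) (Fin p) ℝ} {m : ℕ}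
    (N : (T : Finset (Fin p)) → Finset (EuclideanSpace ℝ T))
    (hN : ∀ T : Finset (Fin p), ∀ v : EuclideanSpace ℝ T, ‖v‖ = 1 → ∃ u ∈ N T, ‖v - u‖ ≤ 1 / 4)
    (h : ∀ T : Finset (Fin p), T.card ≤ m → ∀ u ∈ N T,
      9 / 16 * (n : ℝ) ≤ ∑ i, (X *ᵥ zeroExtend T u) i ^ 2 ∧
      ∑ i, (X *ᵥ zeroExtend T u) i ^ 2 ≤ 25 / 16 * n) :
    SparseLowerBound (1 / 9) m X := by
  intro T v hT hv
  set A : EuclideanSpace ℝ T →L[ℝ] EuclideanSpace ℝ (Fin n) :=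
    LinearMap.toContinuousLinearMap (Matrix.toEuclideanLin (subDesign X T)) with hA
  have hAn : ∀ u : EuclideanSpace ℝ T, ‖A u‖ = √(∑ i, (X *ᵥ zeroExtend T u) i ^ 2) := by
    intro u
    rw [EuclideanSpace.norm_eq, mulVec_zeroExtend]
    simp [hA, Matrix.toEuclideanLin]
  have h1 := norm_lower_bound_of_net A (lo := 3 / 4 * √n) (hi := 5 / 4 * √n) (by positivity)
    (hN T) (fun u hu => ?_) (WithLp.toLp 2 fun j : T => v j)
  · rw [hAn, zeroExtend_restrict hv, EuclideanSpace.norm_eq] at h1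
    have h2 : ∑ j : T, ‖v j‖ ^ 2 = ∑ j, v j ^ 2 := by
      simp only [Real.norm_eq_abs, sq_abs]
      exact sum_coe_eq_sum T (f := fun j => v j ^ 2) fun j hj => by
        simp only [hv j hj]; norm_num
    simp only [h2] at h1
    have h3 : 3 / 4 * √n - 5 / 4 * √n / 3 = 1 / 3 * √n := by ring
    rw [h3] at h1
    have h4 := pow_le_pow_left₀ (by positivity) h1 2
    rw [Real.sq_sqrt (by positivity), mul_pow, mul_pow, Real.sq_sqrt (by positivity),
      Real.sq_sqrt (by positivity)] at h4
    linarith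
  · obtain ⟨h5, h6⟩ := h T hT u hu
    rw [hAn]
    constructor
    · apply Real.le_sqrt_of_sq_le
      rw [mul_pow, Real.sq_sqrt (by positivity)]
      linarith
    · rw [Real.sqrt_le_left (by positivity), mul_pow, Real.sq_sqrt (by positivity)]
      linarith

theorem gaussianDesign_unit_vector_le {v : Fin p → ℝ} (hv : ∑ j, v j ^ 2 = 1) :
    gaussianDesign n p {X | ¬ (9 / 16 * (n : ℝ) ≤ ∑ i, ((Matrix.of X) *ᵥ v) i ^ 2 ∧
      ∑ i, ((Matrix.of X) *ᵥ v) i ^ 2 ≤ 25 / 16 * n)}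
      ≤ ENNReal.ofReal (2 * Real.exp (-(n / 64))) := by
  have hmeas : Measurable fun X : Fin n → Fin p → ℝ => (Matrix.of X) *ᵥ v := by
    refine measurable_pi_lambda _ fun i => ?_
    simp only [mulVec, dotProduct, Matrix.of_apply]
    fun_prop
  have hsum : Measurable fun g : Fin n → ℝ => ∑ i, g i ^ 2 := by fun_prop
  have hms : MeasurableSet {g : Fin n → ℝ | ¬ (9 / 16 * (n : ℝ) ≤ ∑ i, g i ^ 2 ∧
      ∑ i, g i ^ 2 ≤ 25 / 16 * n)} :=
    ((measurableSet_le measurable_const hsum).inter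
      (measurableSet_le hsum measurable_const)).compl
  have e : gaussianDesign n p {X | ¬ (9 / 16 * (n : ℝ) ≤ ∑ i, ((Matrix.of X) *ᵥ v) i ^ 2 ∧
      ∑ i, ((Matrix.of X) *ᵥ v) i ^ 2 ≤ 25 / 16 * n)} = noiseLaw n 1 {g |
      ¬ (9 / 16 * (n : ℝ) ≤ ∑ i, g i ^ 2 ∧ ∑ i, g i ^ 2 ≤ 25 / 16 * n)} := by
    rw [← map_mulVec_gaussianDesign hv, Measure.map_apply hmeas hms]
    rfl
  rw [e]
  refine (measure_mono (t := {g | ∑ i, g i ^ 2 ≤ 9 / 16 * (n : ℝ)} ∪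
    {g | 25 / 16 * (n : ℝ) ≤ ∑ i, g i ^ 2}) fun g hg => ?_).trans ((measure_union_le _ _).trans ?_)
  · simp only [Set.mem_ofPred_eq, not_and_or, not_le] at hg
    exact hg.imp le_of_lt le_of_lt
  · have hn0 : (0 : ℝ) ≤ n := by positivity
    -- With `l = 1/8` the exponents are `-3n/128` and `-5n/128`, both below `-n/64`.
    refine (add_le_add (chiSq_lower_tail n (l := 1 / 8) (by norm_num))
      (chiSq_upper_tail n (l := 1 / 8) (by norm_num) (by norm_num))).trans ?_
    rw [← ENNReal.ofReal_add (by positivity) (by positivity)]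
    apply ENNReal.ofReal_le_ofReal
    rw [two_mul (Real.exp _)]
    exact add_le_add (Real.exp_le_exp.2 (by linarith)) (Real.exp_le_exp.2 (by linarith))

/-- There are at most `2 p^(2k)` supports and `9^(2k) ≤ p^(8k)` net points on each. Since `704 = 64
· 11`, each point fails with probability at most `2 p^(-11k)`, and a factor `p^(-k)` is left over.
-/
theorem gaussianDesign_sparseLowerBound (hp : 2 ≤ p) {k : ℕ} (hk : 1 ≤ k)
    (hn : 704 * (k * Real.log p) ≤ n) :
    gaussianDesign n p {X | ¬ SparseLowerBound (1 / 9) (2 * k) (Matrix.of X)}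
      ≤ ENNReal.ofReal (4 / p) := by
  choose N hN1 hN2 hN3 using fun T : Finset (Fin p) => exists_quarter_net (EuclideanSpace ℝ T)
  have hp0 : (0 : ℝ) < p := by exact_mod_cast (by omega : 0 < p)
  have hL := log_natCast_pos hp
  set I := Finset.univ.filter fun T : Finset (Fin p) => T.card ≤ 2 * k
  set B : (T : Finset (Fin p)) → EuclideanSpace ℝ T → Set (Fin n → Fin p → ℝ) := fun T u =>
    {X | ¬ (9 / 16 * (n : ℝ) ≤ ∑ i, ((Matrix.of X) *ᵥ zeroExtend T u) i ^ 2 ∧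
      ∑ i, ((Matrix.of X) *ᵥ zeroExtend T u) i ^ 2 ≤ 25 / 16 * n)} with hB
  have hsub : {X : Fin n → Fin p → ℝ | ¬ SparseLowerBound (1 / 9) (2 * k) (Matrix.of X)}
      ⊆ ⋃ T ∈ I, ⋃ u ∈ N T, B T u := by
    intro X hX
    by_contra hcon
    refine hX (sparseLowerBound_of_net N hN3 fun T hT u hu => ?_)
    simp only [Set.mem_iUnion, not_exists] at hcon
    have := hcon T (Finset.mem_filter.2 ⟨Finset.mem_univ _, hT⟩) u hu
    simpa only [hB, Set.mem_ofPred_eq, not_not] using this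
  refine (measure_mono hsub).trans ?_
  have hI : (I.card : ℝ) ≤ 2 * (p : ℝ) ^ (2 * k) := by
    exact_mod_cast card_filter_card_le hp (2 * k)
  refine (measure_biUnion_le_card_mul _ I (q := (p : ℝ) ^ (8 * k) * (2 * Real.exp (-(n / 64)))) hI
    (by positivity) fun T hT => ?_).trans ?_
  · have hcard : ((N T).card : ℝ) ≤ (p : ℝ) ^ (8 * k) := by
      have h1 := hN2 T
      rw [finrank_euclideanSpace, Fintype.card_coe] at h1
      have h2 : 9 ^ T.card ≤ p ^ (8 * k) := by
        calc 9 ^ T.card ≤ 9 ^ (2 * k) :=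
              Nat.pow_le_pow_right (by norm_num) (Finset.mem_filter.1 hT).2
          _ ≤ (p ^ 4) ^ (2 * k) := by
              apply Nat.pow_le_pow_left
              calc 9 ≤ 2 ^ 4 := by norm_num
                _ ≤ p ^ 4 := Nat.pow_le_pow_left hp 4
          _ = p ^ (8 * k) := by rw [← pow_mul]; congr 1; ring
      exact_mod_cast h1.trans h2
    refine measure_biUnion_le_card_mul _ _ hcard (by positivity) fun u hu => ?_
    refine gaussianDesign_unit_vector_le ?_
    rw [sum_sq_zeroExtend]
    have h1 := hN1 T u hu
    rw [EuclideanSpace.norm_eq, Real.sqrt_eq_one] at h1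
    simpa using h1
  · apply ENNReal.ofReal_le_ofReal
    have hexp : Real.exp (-(n / 64)) ≤ ((p : ℝ) ^ (11 * k))⁻¹ := by
      have h1 : (p : ℝ) ^ (11 * k) = Real.exp (11 * (k * Real.log p)) := by
        rw [← Real.rpow_natCast, Real.rpow_def_of_pos hp0]
        congr 1; push_cast; ring
      rw [h1, ← Real.exp_neg]
      apply Real.exp_le_exp.2
      linarith
    have hpk : (p : ℝ) ≤ (p : ℝ) ^ k :=
      le_self_pow₀ (by exact_mod_cast (by omega : 1 ≤ p)) (by omega)
    calc 2 * (p : ℝ) ^ (2 * k) * ((p : ℝ) ^ (8 * k) * (2 * Real.exp (-(n / 64))))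
        ≤ 2 * (p : ℝ) ^ (2 * k) * ((p : ℝ) ^ (8 * k) * (2 * ((p : ℝ) ^ (11 * k))⁻¹)) := by gcongr
      _ = 4 / (p : ℝ) ^ k := by
          rw [show 11 * k = 2 * k + 8 * k + k by ring, pow_add, pow_add]
          field_simp
          norm_num
      _ ≤ 4 / p := by gcongr

/-! ### The restricted eigenvalue -/

/-- The vector `A_z⁻¹ X v` is `X` applied to `v` minus a vector supported on `z`. As `v` vanishes on
`z`, the subtraction cannot shorten it, and the support has at most `k + k` elements. -/
theorem restrictedEigenvalue_ge (hp : 2 ≤ p) {k : ℕ} (hk : 1 ≤ k) {σ τ₁ c : ℝ} (hc : 0 ≤ c)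
    {X : Matrix (Fin n) (Fin p) ℝ} (hX : SparseLowerBound c (2 * k) X) :
    c * n ≤ restrictedEigenvalue σ τ₁ X k := by
  classical
  apply le_csInf
  · have j₀ : Fin p := ⟨0, by omega⟩
    refine ⟨_, ∅, Pi.single j₀ 1, by simp, by simp, ?_, by simp [Pi.single_apply], rfl⟩
    have : {j | (Pi.single j₀ (1 : ℝ) : Fin p → ℝ) j ≠ 0} = {j₀} := by
      ext j; simp [Pi.single_apply]
    rw [this, Set.ncard_singleton]; exact hk
  · rintro r ⟨z, v, hz, hvz, hvk, hv1, rfl⟩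
    refine le_trans ?_ (dotProduct_modelInv_mulVec_ge σ τ₁ X z (X *ᵥ v))
    have h := add_smul_modelInv_mulVec σ τ₁ X z (X *ᵥ v)
    generalize modelInv σ τ₁ X z *ᵥ (X *ᵥ v) = x at h ⊢
    set u : z → ℝ := (τ₁ ^ 2 / σ ^ 2) • ((subDesign X z)ᵀ *ᵥ x) with hu
    have hx : x = X *ᵥ (v - zeroExtend z u) := by
      rw [mulVec_sub, mulVec_zeroExtend, hu, mulVec_smul]
      exact eq_sub_of_add_eq h
    have hT : (Finset.univ.filter (fun j => v j ≠ 0) ∪ z).card ≤ 2 * k := by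
      refine (Finset.card_union_le _ _).trans ?_
      have : (Finset.univ.filter (fun j => v j ≠ 0)).card ≤ k := by
        rw [← Set.ncard_coe_finset]; simpa using hvk
      omega
    have h1 := hX _ (v - zeroExtend z u) hT (fun j hj => by
      simp only [Finset.mem_union, Finset.mem_filter, Finset.mem_univ, true_and, not_or,
        not_not] at hj
      rw [Pi.sub_apply, hj.1, zeroExtend_of_notMem u hj.2, sub_zero])
    rw [← hx] at h1
    have h2 : 1 ≤ ∑ j, (v - zeroExtend z u) j ^ 2 := by
      rw [← hv1]
      refine Finset.sum_le_sum fun j _ => ?_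
      by_cases hj : j ∈ z
      · rw [hvz j hj, zero_pow two_ne_zero]; exact sq_nonneg _
      · rw [Pi.sub_apply, zeroExtend_of_notMem u hj, sub_zero]
    rw [dotProduct_self_eq_sum_sq]
    exact (le_mul_of_one_le_right (by positivity) h2).trans h1

theorem restrictedEigenvalue_gaussian_design :
    ∃ C₀ c C : ℝ, 0 < C₀ ∧ 0 < c ∧ ∀ (n p k : ℕ), 2 ≤ p → 1 ≤ k →
      C₀ * (k * Real.log p) ≤ n → ∀ (σ τ₁ : ℝ), 0 < σ → 0 < τ₁ →
        gaussianDesign n p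
          {X | ¬ c * (n : ℝ) ≤ restrictedEigenvalue σ τ₁ (Matrix.of X) k}
          ≤ ENNReal.ofReal (C / p) := by
  refine ⟨704, 1 / 9, 4, by norm_num, by norm_num, fun n p k hp hk hn σ τ₁ _ _ => ?_⟩
  refine (measure_mono fun X hX => ?_).trans (gaussianDesign_sparseLowerBound hp hk hn)
  exact fun hcon => hX (restrictedEigenvalue_ge hp hk (by norm_num) hcon)

/-! ### Deterministic analysis of the Lasso -/

/-- An exact expansion around a point satisfying complementary slackness. Once the gradient is
bounded by `lam`, every term of the excess is nonnegative, so both optimality and uniqueness can be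
read off. -/
theorem lasso_objective_eq (X : Matrix (Fin n) (Fin p) ℝ) (y : Fin n → ℝ) (lam : ℝ)
    (b' b : Fin p → ℝ) (hb : ∀ j, (2 * (Xᵀ *ᵥ (y - X *ᵥ b)) j) * b j = lam * |b j|) :
    ∑ i, (y i - (X *ᵥ b') i) ^ 2 + lam * ∑ j, |b' j|
      = ∑ i, (y i - (X *ᵥ b) i) ^ 2 + lam * ∑ j, |b j| + (∑ i, (X *ᵥ (b' - b)) i ^ 2
        + ∑ j, (lam * |b' j| - (2 * (Xᵀ *ᵥ (y - X *ᵥ b)) j) * b' j)) := by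
  have h1 : ∑ i, (y i - (X *ᵥ b') i) ^ 2 = ∑ i, (y i - (X *ᵥ b) i) ^ 2
      - 2 * ((y - X *ᵥ b) ⬝ᵥ (X *ᵥ (b' - b))) + ∑ i, (X *ᵥ (b' - b)) i ^ 2 := by
    simp only [dotProduct, Finset.mul_sum]
    rw [← Finset.sum_sub_distrib, ← Finset.sum_add_distrib]
    refine Finset.sum_congr rfl fun i _ => ?_
    simp only [mulVec_sub, Pi.sub_apply]
    ring
  have h2 : (y - X *ᵥ b) ⬝ᵥ (X *ᵥ (b' - b)) = ∑ j, (Xᵀ *ᵥ (y - X *ᵥ b)) j * (b' j - b j) := by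
    rw [dotProduct_mulVec, ← mulVec_transpose]; rfl
  have h3 : lam * ∑ j, |b j| = ∑ j, (2 * (Xᵀ *ᵥ (y - X *ᵥ b)) j) * b j := by
    rw [Finset.mul_sum]; exact Finset.sum_congr rfl fun j _ => (hb j).symm
  rw [h1, h2, h3, Finset.mul_sum, Finset.mul_sum, Finset.sum_sub_distrib]
  have h4 : ∑ j, 2 * ((Xᵀ *ᵥ (y - X *ᵥ b)) j * (b' j - b j))
      = ∑ j, 2 * (Xᵀ *ᵥ (y - X *ᵥ b)) j * b' j - ∑ j, 2 * (Xᵀ *ᵥ (y - X *ᵥ b)) j * b j := by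
    rw [← Finset.sum_sub_distrib]; exact Finset.sum_congr rfl fun j _ => by ring
  rw [h4]; ring

theorem mul_le_mul_abs_of_abs_le {g lam x : ℝ} (h : |g| ≤ lam) : g * x ≤ lam * |x| :=
  (le_abs_self _).trans (by rw [abs_mul]; gcongr)

/-- The optimality conditions identify a minimizer of the Lasso objective. -/
theorem isLasso_of_kkt {X : Matrix (Fin n) (Fin p) ℝ} {y : Fin n → ℝ} {lam : ℝ} {b : Fin p → ℝ}
    (hb : ∀ j, (2 * (Xᵀ *ᵥ (y - X *ᵥ b)) j) * b j = lam * |b j|)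
    (hg : ∀ j, |2 * (Xᵀ *ᵥ (y - X *ᵥ b)) j| ≤ lam) : IsLasso X y lam b := by
  intro b'
  rw [lasso_objective_eq X y lam b' b hb]
  have h1 : 0 ≤ ∑ i, (X *ᵥ (b' - b)) i ^ 2 := Finset.sum_nonneg fun i _ => sq_nonneg _
  have h2 : 0 ≤ ∑ j, (lam * |b' j| - (2 * (Xᵀ *ᵥ (y - X *ᵥ b)) j) * b' j) :=
    Finset.sum_nonneg fun j _ => sub_nonneg.2 (mul_le_mul_abs_of_abs_le (hg j))
  linarith

theorem eq_zero_of_sum_sq_le {c : ℝ} (hc : 0 < c) (hn : 0 < n) {m : ℕ}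
    {X : Matrix (Fin n) (Fin p) ℝ} (hX : SparseLowerBound c m X) {T : Finset (Fin p)}
    (hT : T.card ≤ m) {v : Fin p → ℝ} (hv : ∀ j ∉ T, v j = 0)
    (h : ∑ i, (X *ᵥ v) i ^ 2 ≤ 0) : v = 0 := by
  have hn0 : (0 : ℝ) < n := by exact_mod_cast hn
  have h1 := (hX T v hT hv).trans h
  have h2 : ∑ j, v j ^ 2 ≤ 0 := by
    by_contra! h3
    exact absurd h1 (not_le.2 (by positivity))
  ext j
  have h3 := (Finset.single_le_sum (fun j _ => sq_nonneg (v j)) (Finset.mem_univ j)).trans h2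
  exact pow_eq_zero_iff two_ne_zero |>.1 (le_antisymm h3 (sq_nonneg _))

/-- Under strict dual feasibility the minimizer of the Lasso objective is unique. -/
theorem eq_of_isLasso_of_kkt {X : Matrix (Fin n) (Fin p) ℝ} {y : Fin n → ℝ} {lam c : ℝ}
    {b : Fin p → ℝ} {m : ℕ} {S : Finset (Fin p)} (hc : 0 < c) (hn : 0 < n)
    (hX : SparseLowerBound c m X) (hS : S.card ≤ m) (hbS : ∀ j ∉ S, b j = 0)
    (hb : ∀ j, (2 * (Xᵀ *ᵥ (y - X *ᵥ b)) j) * b j = lam * |b j|)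
    (hg : ∀ j, |2 * (Xᵀ *ᵥ (y - X *ᵥ b)) j| ≤ lam)
    (hgS : ∀ j ∉ S, |2 * (Xᵀ *ᵥ (y - X *ᵥ b)) j| < lam)
    {b' : Fin p → ℝ} (hb' : IsLasso X y lam b') : b' = b := by
  have h := hb' b
  rw [lasso_objective_eq X y lam b' b hb] at h
  have h0 : ∀ j, 0 ≤ lam * |b' j| - (2 * (Xᵀ *ᵥ (y - X *ᵥ b)) j) * b' j :=
    fun j => sub_nonneg.2 (mul_le_mul_abs_of_abs_le (hg j))
  have h1 : 0 ≤ ∑ i, (X *ᵥ (b' - b)) i ^ 2 := Finset.sum_nonneg fun i _ => sq_nonneg _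
  have h2 := Finset.sum_nonneg fun j (_ : j ∈ Finset.univ) => h0 j
  have h3 : ∀ j ∉ S, b' j = 0 := by
    intro j hj
    have h4 := (Finset.single_le_sum (fun j _ => h0 j) (Finset.mem_univ j)).trans
      (show _ ≤ (0 : ℝ) by linarith)
    by_contra hne
    have h5 : 2 * (Xᵀ *ᵥ (y - X *ᵥ b)) j * b' j
        ≤ |2 * (Xᵀ *ᵥ (y - X *ᵥ b)) j| * |b' j| := by rw [← abs_mul]; exact le_abs_self _
    have h6 := mul_lt_mul_of_pos_right (hgS j hj) (abs_pos.2 hne)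
    linarith
  exact sub_eq_zero.1 (eq_zero_of_sum_sq_le hc hn hX hS
    (fun j hj => by rw [Pi.sub_apply, h3 j hj, hbS j hj, sub_zero]) (by linarith))

/-! ### Least squares on a model -/

/-- The coefficient vector `(X_Rᵀ X_R)⁻¹ r`. -/
def gramSolve (X : Matrix (Fin n) (Fin p) ℝ) (R : Finset (Fin p)) (r : R → ℝ) : R → ℝ :=
  ((subDesign X R)ᵀ * subDesign X R)⁻¹ *ᵥ r

/-- The vector `X_R (X_Rᵀ X_R)⁻¹ r`. -/
def gramLift (X : Matrix (Fin n) (Fin p) ℝ) (R : Finset (Fin p)) (r : R → ℝ) : Fin n → ℝ :=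
  subDesign X R *ᵥ gramSolve X R r

section gram

variable {c : ℝ} {m : ℕ} {X : Matrix (Fin n) (Fin p) ℝ} {R : Finset (Fin p)}

theorem SparseLowerBound.subDesign_ge (hX : SparseLowerBound c m X) (hR : R.card ≤ m)
    (u : R → ℝ) : c * n * ∑ j, u j ^ 2 ≤ ∑ i, (subDesign X R *ᵥ u) i ^ 2 := by
  have := hX R (zeroExtend R u) hR fun j hj => zeroExtend_of_notMem u hj
  rwa [sum_sq_zeroExtend, mulVec_zeroExtend] at this

/-- The sparse lower bound makes the Gram matrix injective, so the inverse in `gramSolve` is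
genuine. -/
theorem transpose_mulVec_gramLift (hc : 0 < c) (hn : 0 < n) (hX : SparseLowerBound c m X)
    (hR : R.card ≤ m) (r : R → ℝ) : (subDesign X R)ᵀ *ᵥ gramLift X R r = r := by
  have hn0 : (0 : ℝ) < n := by exact_mod_cast hn
  have hinj : Function.Injective ((subDesign X R)ᵀ * subDesign X R).mulVec := by
    intro u v huv
    have h0 : ((subDesign X R)ᵀ * subDesign X R) *ᵥ (u - v) = 0 := by
      rw [mulVec_sub]; exact sub_eq_zero.2 huv
    have h1 : ∑ i, (subDesign X R *ᵥ (u - v)) i ^ 2 = 0 := by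
      rw [← dotProduct_self_eq_sum_sq, dotProduct_mulVec, ← mulVec_transpose, mulVec_mulVec, h0,
        zero_dotProduct]
    have h2 := (hX.subDesign_ge hR (u - v)).trans h1.le
    have h3 : ∑ j, (u - v) j ^ 2 ≤ 0 := by
      by_contra! h3
      exact absurd h2 (not_le.2 (by positivity))
    ext j
    have h4 := (Finset.single_le_sum (fun j _ => sq_nonneg ((u - v) j)) (Finset.mem_univ j)).trans h3
    exact sub_eq_zero.1 (pow_eq_zero_iff two_ne_zero |>.1 (le_antisymm h4 (sq_nonneg _)))
  have hunit := (Matrix.isUnit_iff_isUnit_det _).1 (Matrix.mulVec_injective_iff_isUnit.1 hinj)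
  rw [gramLift, gramSolve, mulVec_mulVec, mulVec_mulVec, Matrix.mul_nonsing_inv _ hunit,
    one_mulVec]

theorem gramLift_dotProduct (X : Matrix (Fin n) (Fin p) ℝ) (R : Finset (Fin p)) (r : R → ℝ)
    (x : Fin n → ℝ) : gramLift X R r ⬝ᵥ x = gramSolve X R r ⬝ᵥ ((subDesign X R)ᵀ *ᵥ x) := by
  rw [gramLift, dotProduct_comm, dotProduct_mulVec, ← mulVec_transpose, dotProduct_comm]

theorem dotProduct_gramSolve (hc : 0 < c) (hn : 0 < n) (hX : SparseLowerBound c m X)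
    (hR : R.card ≤ m) (r r' : R → ℝ) :
    gramSolve X R r ⬝ᵥ r' = gramLift X R r ⬝ᵥ gramLift X R r' := by
  rw [gramLift_dotProduct, transpose_mulVec_gramLift hc hn hX hR]

/-- With `u = gramSolve X R r`, the left side `W` equals `⟨u, r⟩`, and `2cn⟨u, r⟩ ≤ (cn)²‖u‖² + ‖r‖²
≤ cnW + ‖r‖²`. -/
theorem sum_sq_gramLift_le (hc : 0 < c) (hn : 0 < n) (hX : SparseLowerBound c m X)
    (hR : R.card ≤ m) (r : R → ℝ) :
    ∑ i, gramLift X R r i ^ 2 ≤ (∑ j, r j ^ 2) / (c * n) := by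
  have hn0 : (0 : ℝ) < n := by exact_mod_cast hn
  have hcn : 0 < c * n := by positivity
  have h1 := hX.subDesign_ge hR (gramSolve X R r)
  rw [← gramLift] at h1
  have h2 := dotProduct_gramSolve hc hn hX hR r r
  rw [dotProduct_self_eq_sum_sq] at h2
  rw [le_div_iff₀ hcn]
  set W := ∑ i, gramLift X R r i ^ 2
  have h3 : 2 * (c * n) * (gramSolve X R r ⬝ᵥ r)
      ≤ (c * n) * (c * n) * ∑ j, gramSolve X R r j ^ 2 + ∑ j, r j ^ 2 := by
    simp only [dotProduct, Finset.mul_sum]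
    rw [← Finset.sum_add_distrib]
    refine Finset.sum_le_sum fun j _ => ?_
    nlinarith [sq_nonneg (c * n * gramSolve X R r j - r j)]
  have h4 := mul_le_mul_of_nonneg_left h1 hcn.le
  rw [h2] at h3
  nlinarith

/-- The residual of the projection on the columns of a model is not longer than the vector. -/
theorem sum_sq_sub_gramLift_le (hc : 0 < c) (hn : 0 < n) (hX : SparseLowerBound c m X)
    (hR : R.card ≤ m) (x : Fin n → ℝ) :
    ∑ i, (x - gramLift X R ((subDesign X R)ᵀ *ᵥ x)) i ^ 2 ≤ ∑ i, x i ^ 2 := by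
  have h1 := gramLift_dotProduct X R ((subDesign X R)ᵀ *ᵥ x) x
  rw [dotProduct_gramSolve hc hn hX hR] at h1
  rw [← dotProduct_self_eq_sum_sq, ← dotProduct_self_eq_sum_sq]
  set y := gramLift X R ((subDesign X R)ᵀ *ᵥ x)
  have h2 := dotProduct_self_nonneg_real y
  rw [sub_dotProduct, dotProduct_sub, dotProduct_sub, dotProduct_comm x y]
  linarith

theorem subDesign_transpose_mulVec (X : Matrix (Fin n) (Fin p) ℝ) (R : Finset (Fin p))
    (x : Fin n → ℝ) (j : R) : ((subDesign X R)ᵀ *ᵥ x) j = (Xᵀ *ᵥ x) j := rfl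

/-- The coefficients of `(X_Sᵀ X_S)⁻¹ s` are bounded through the least squares fits on the
models that leave out one column. -/
theorem abs_gramSolve_le (hc : 0 < c) (hn : 0 < n) (hX : SparseLowerBound c m X)
    {S : Finset (Fin p)} (hS : S.card ≤ m) (s : Fin p → ℝ) (j : S) (hs : |s j| ≤ 1)
    (hw : |(Xᵀ *ᵥ gramLift X (S.erase j) (fun i => s i)) j| ≤ 1 / 2) :
    |gramSolve X S (fun i => s i) j| ≤ 3 / (2 * (c * n)) := by
  have hn0 : (0 : ℝ) < n := by exact_mod_cast hn
  have hR : (S.erase (j : Fin p)).card ≤ m := (Finset.card_erase_le).trans hS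
  set U := zeroExtend S (gramSolve X S fun i => s i) with hU
  set V := zeroExtend (S.erase (j : Fin p)) (gramSolve X (S.erase (j : Fin p)) fun i => s i) with hV
  have hXU : X *ᵥ U = gramLift X S fun i => s i := mulVec_zeroExtend _ _ _
  have hXV : X *ᵥ V = gramLift X (S.erase (j : Fin p)) fun i => s i := mulVec_zeroExtend _ _ _
  have hUs : ∀ i ∈ S, (Xᵀ *ᵥ (X *ᵥ U)) i = s i := by
    intro i hi
    rw [hXU, ← subDesign_transpose_mulVec X S _ ⟨i, hi⟩, transpose_mulVec_gramLift hc hn hX hS]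
  have hVs : ∀ i ∈ S.erase (j : Fin p), (Xᵀ *ᵥ (X *ᵥ V)) i = s i := by
    intro i hi
    rw [hXV, ← subDesign_transpose_mulVec X _ _ ⟨i, hi⟩, transpose_mulVec_gramLift hc hn hX hR]
  have hUj : U j = gramSolve X S (fun i => s i) j := zeroExtend_coe _ j
  have hVj : V j = 0 := zeroExtend_of_notMem _ (Finset.notMem_erase _ _)
  have hsupp : ∀ i ∉ S, (U - V) i = 0 := by
    intro i hi
    rw [Pi.sub_apply, hU, hV, zeroExtend_of_notMem _ hi,
      zeroExtend_of_notMem _ fun h => hi (Finset.mem_of_mem_erase h), sub_zero]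
  have h1 := hX S (U - V) hS hsupp
  -- Both fits reproduce `s` on `S \ {j}` and `U - V` lives on `S`, so only the coordinate `j`
  -- contributes to `⟨U - V, XᵀX(U - V)⟩`.
  have h2 : ∑ i, (X *ᵥ (U - V)) i ^ 2
      = U j * (s j - (Xᵀ *ᵥ gramLift X (S.erase j) (fun i => s i)) j) := by
    rw [← dotProduct_self_eq_sum_sq, dotProduct_mulVec, ← mulVec_transpose, dotProduct,
      Finset.sum_eq_single (j : Fin p)]
    · rw [mulVec_sub X, mulVec_sub Xᵀ, Pi.sub_apply, Pi.sub_apply, hUs j j.2, hXV, hVj]; ring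
    · intro i _ hij
      by_cases hi : i ∈ S
      · rw [mulVec_sub X, mulVec_sub Xᵀ, Pi.sub_apply, hUs i hi,
          hVs i (Finset.mem_erase.2 ⟨hij, hi⟩), sub_self, zero_mul]
      · rw [hsupp i hi, mul_zero]
    · simp
  have h3 : U j ^ 2 ≤ ∑ i, (U - V) i ^ 2 := by
    have := Finset.single_le_sum (fun i _ => sq_nonneg ((U - V) i)) (Finset.mem_univ (j : Fin p))
    rwa [Pi.sub_apply, hVj, sub_zero] at this
  have h4 : |s j - (Xᵀ *ᵥ gramLift X (S.erase j) (fun i => s i)) j| ≤ 3 / 2 :=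
    (abs_sub _ _).trans (by linarith)
  rw [h2] at h1
  have hcn : 0 < c * n := by positivity
  have h5 : c * n * |U j| ^ 2 ≤ |U j| * (3 / 2) := by
    rw [sq_abs]
    calc c * n * U j ^ 2 ≤ c * n * ∑ i, (U - V) i ^ 2 := by gcongr
      _ ≤ _ := h1
      _ ≤ |U j| * |s j - (Xᵀ *ᵥ gramLift X (S.erase j) (fun i => s i)) j| := by
          rw [← abs_mul]; exact le_abs_self _
      _ ≤ _ := by gcongr
  rw [← hUj, le_div_iff₀ (by positivity)]
  rcases (abs_nonneg (U j)).eq_or_lt with h0 | hpos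
  · rw [← h0]; norm_num
  · have h6 : |U j| * (c * n * |U j|) ≤ |U j| * (3 / 2) := by linarith
    have := le_of_mul_le_mul_left h6 hpos
    linarith

end gram

/-! ### Exact support recovery -/

/-- The direction in which the noise enters the optimality conditions at the column `j`. -/
def noiseDirection (X : Matrix (Fin n) (Fin p) ℝ) (S : Finset (Fin p)) (j : Fin p) : Fin n → ℝ :=
  if h : j ∈ S then gramLift X S (Pi.single ⟨j, h⟩ 1)
  else X.col j - gramLift X S ((subDesign X S)ᵀ *ᵥ X.col j)

/-- The witness is `βstar + δ`, where `δ` solves the stationarity equations on `S` with the signs of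
`βstar`. On `S`, `|δ_j| ≤ A + 3 lam / (4cn)` is too small to flip a sign; off `S`, the gradient is
at most `2D + lam / 2 < lam`. For `j ∉ S` erasing `j` changes nothing, so `hw` serves both cases. -/
theorem lasso_support_recovery {c : ℝ} {m : ℕ} {X : Matrix (Fin n) (Fin p) ℝ}
    {S : Finset (Fin p)} (hc : 0 < c) (hn : 0 < n) (hX : SparseLowerBound c m X)
    (hS : S.card ≤ m) {βstar : Fin p → ℝ} (hβS : ∀ j, j ∈ S ↔ βstar j ≠ 0)
    {ε : Fin n → ℝ} {lam A D : ℝ} (hlam : 0 < lam) (hD : 4 * D < lam)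
    (hA : ∀ j ∈ S, A + 3 * lam / (4 * (c * n)) < |βstar j|)
    (hw : ∀ j, |(Xᵀ *ᵥ gramLift X (S.erase j) (fun i => (SignType.sign (βstar i) : ℝ))) j| ≤ 1 / 2)
    (hin : ∀ j ∈ S, |noiseDirection X S j ⬝ᵥ ε| ≤ A)
    (hout : ∀ j ∉ S, |noiseDirection X S j ⬝ᵥ ε| ≤ D) :
    (∃ b, IsLasso X (X *ᵥ βstar + ε) lam b) ∧
      ∀ b, IsLasso X (X *ᵥ βstar + ε) lam b → ∀ j, b j ≠ 0 ↔ βstar j ≠ 0 := by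
  set s : Fin p → ℝ := fun i => (SignType.sign (βstar i) : ℝ) with hs
  have hsabs : ∀ j ∈ S, s j * βstar j = |βstar j| ∧ s j * s j = 1 ∧ |s j| = 1 := by
    intro j hj
    rcases lt_or_gt_of_ne ((hβS j).1 hj) with h | h
    · simp [hs, sign_neg h, abs_of_neg h]
    · simp [hs, sign_pos h, abs_of_pos h]
  set u := gramSolve X S ((subDesign X S)ᵀ *ᵥ ε) with hu
  set v := gramSolve X S (fun i => s i) with hv
  set δ := zeroExtend S (u - (lam / 2) • v) with hδ
  set b := βstar + δ with hb
  have hcn : 0 < c * n := mul_pos hc (by exact_mod_cast hn)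
  have hXδ : X *ᵥ δ = gramLift X S ((subDesign X S)ᵀ *ᵥ ε)
      - (lam / 2) • gramLift X S (fun i => s i) := by
    rw [hδ, mulVec_zeroExtend, mulVec_sub, mulVec_smul]; rfl
  have hres : X *ᵥ βstar + ε - X *ᵥ b = ε - X *ᵥ δ := by
    rw [hb, mulVec_add]; abel
  have hbS : ∀ j ∉ S, b j = 0 := by
    intro j hj
    have h1 : βstar j = 0 := by
      by_contra h; exact hj ((hβS j).2 h)
    rw [hb, Pi.add_apply, h1, hδ, zeroExtend_of_notMem _ hj, add_zero]
  have hgin : ∀ j ∈ S, 2 * (Xᵀ *ᵥ (X *ᵥ βstar + ε - X *ᵥ b)) j = lam * s j := by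
    intro j hj
    rw [hres, hXδ, ← subDesign_transpose_mulVec X S _ ⟨j, hj⟩, mulVec_sub, mulVec_sub, mulVec_smul,
      transpose_mulVec_gramLift hc hn hX hS, transpose_mulVec_gramLift hc hn hX hS]
    simp only [Pi.sub_apply, Pi.smul_apply, smul_eq_mul]
    ring
  have hδj : ∀ j ∈ S, |δ j| < |βstar j| := by
    intro j hj
    have h1 : δ j = u ⟨j, hj⟩ - lam / 2 * v ⟨j, hj⟩ := zeroExtend_coe (T := S) _ ⟨j, hj⟩
    have h2 : u ⟨j, hj⟩ = noiseDirection X S j ⬝ᵥ ε := by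
      rw [noiseDirection, dif_pos hj, gramLift_dotProduct, dotProduct_gramSolve hc hn hX hS,
        dotProduct_comm, ← dotProduct_gramSolve hc hn hX hS, ← hu]
      simp
    have h3 := abs_gramSolve_le hc hn hX hS s ⟨j, hj⟩ (hsabs j hj).2.2.le (hw j)
    have h4 : lam / 2 * |v ⟨j, hj⟩| ≤ lam / 2 * (3 / (2 * (c * n))) := by gcongr
    have h5 : lam / 2 * (3 / (2 * (c * n))) = 3 * lam / (4 * (c * n)) := by
      field_simp; norm_num
    calc |δ j| ≤ |u ⟨j, hj⟩| + lam / 2 * |v ⟨j, hj⟩| := by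
          rw [h1]
          refine (abs_sub _ _).trans (le_of_eq ?_)
          rw [abs_mul, abs_of_pos (half_pos hlam)]
      _ ≤ A + 3 * lam / (4 * (c * n)) := by
          rw [h2]
          linarith [hin j hj]
      _ < _ := hA j hj
  have hsb : ∀ j ∈ S, 0 < s j * b j := by
    intro j hj
    have h1 := neg_abs_le (s j * δ j)
    rw [abs_mul, (hsabs j hj).2.2, one_mul] at h1
    have h2 : s j * b j = |βstar j| + s j * δ j := by
      rw [hb, Pi.add_apply, mul_add, (hsabs j hj).1]
    linarith [hδj j hj]
  have hkkt : ∀ j, (2 * (Xᵀ *ᵥ (X *ᵥ βstar + ε - X *ᵥ b)) j) * b j = lam * |b j| := by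
    intro j
    by_cases hj : j ∈ S
    · rw [hgin j hj, mul_assoc, ← abs_of_pos (hsb j hj), abs_mul, (hsabs j hj).2.2, one_mul]
    · rw [hbS j hj, abs_zero, mul_zero, mul_zero]
  have hgout : ∀ j ∉ S, |2 * (Xᵀ *ᵥ (X *ᵥ βstar + ε - X *ᵥ b)) j| < lam := by
    intro j hj
    have h1 : (Xᵀ *ᵥ (ε - X *ᵥ δ)) j
        = noiseDirection X S j ⬝ᵥ ε + lam / 2 * (Xᵀ *ᵥ gramLift X S (fun i => s i)) j := by
      have hcol : ∀ x, (Xᵀ *ᵥ x) j = X.col j ⬝ᵥ x := fun x => rfl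
      rw [hXδ, mulVec_sub, mulVec_sub, mulVec_smul, noiseDirection, dif_neg hj, sub_dotProduct,
        gramLift_dotProduct, dotProduct_gramSolve hc hn hX hS, dotProduct_comm (gramLift _ _ _),
        ← dotProduct_gramSolve hc hn hX hS, ← gramLift_dotProduct,
        dotProduct_comm (gramLift X S _) (X.col j)]
      simp only [Pi.sub_apply, Pi.smul_apply, smul_eq_mul, hcol]
      ring
    have h2 := hw j
    rw [Finset.erase_eq_of_notMem hj] at h2
    rw [hres, h1, abs_mul, abs_two]
    have h3 : |lam / 2 * (Xᵀ *ᵥ gramLift X S (fun i => s i)) j| ≤ lam / 2 * (1 / 2) := by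
      rw [abs_mul, abs_of_pos (half_pos hlam)]; gcongr
    have h4 := abs_add_le (noiseDirection X S j ⬝ᵥ ε)
      (lam / 2 * (Xᵀ *ᵥ gramLift X S (fun i => s i)) j)
    linarith [hout j hj]
  have hgle : ∀ j, |2 * (Xᵀ *ᵥ (X *ᵥ βstar + ε - X *ᵥ b)) j| ≤ lam := by
    intro j
    by_cases hj : j ∈ S
    · rw [hgin j hj, abs_mul, (hsabs j hj).2.2, mul_one, abs_of_pos hlam]
    · exact (hgout j hj).le
  refine ⟨⟨b, isLasso_of_kkt hkkt hgle⟩, fun b' hb' j => ?_⟩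
  rw [eq_of_isLasso_of_kkt hc hn hX hS hbS hkkt hgle hgout hb', ← hβS j]
  refine ⟨fun h => ?_, fun hj h0 => ?_⟩
  · by_contra hj; exact h (hbS j hj)
  · have := hsb j hj
    rw [h0, mul_zero] at this
    exact lt_irrefl _ this

/-! ### Resampling a column of the design -/

theorem measurePreserving_update_pi {ι : Type*} [Fintype ι] [DecidableEq ι] (μ : Measure ℝ)
    [IsProbabilityMeasure μ] (j : ι) :
    MeasurePreserving (fun q : (ι → ℝ) × ℝ => Function.update q.1 j q.2)
      ((Measure.pi fun _ => μ).prod μ) (Measure.pi fun _ => μ) := by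
  have hm : Measurable fun q : (ι → ℝ) × ℝ => Function.update q.1 j q.2 := by
    refine measurable_pi_lambda _ fun i => ?_
    simp only [Function.update_apply]
    split_ifs <;> fun_prop
  refine ⟨hm, (Measure.pi_eq fun s hs => ?_).symm⟩
  have hpre : (fun q : (ι → ℝ) × ℝ => Function.update q.1 j q.2) ⁻¹' Set.univ.pi s
      = (Set.univ.pi (Function.update s j Set.univ)) ×ˢ s j := by
    ext q
    simp only [Set.mem_preimage, Set.mem_pi, Set.mem_univ, true_implies, Set.mem_prod]
    constructor
    · refine fun h => ⟨fun i => ?_, by simpa using h j⟩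
      rcases eq_or_ne i j with rfl | hij
      · simp
      · simpa [hij] using h i
    · rintro ⟨h1, h2⟩ i
      rcases eq_or_ne i j with rfl | hij
      · simpa using h2
      · simpa [hij] using h1 i
  rw [Measure.map_apply hm (MeasurableSet.univ_pi hs), hpre, Measure.prod_prod, Measure.pi_pi,
    ← Finset.mul_prod_erase Finset.univ _ (Finset.mem_univ j),
    ← Finset.mul_prod_erase Finset.univ (fun i => μ (s i)) (Finset.mem_univ j),
    Function.update_self, measure_univ, one_mul, mul_comm]
  congr 1
  exact Finset.prod_congr rfl fun i hi => by
    rw [Function.update_of_ne (Finset.ne_of_mem_erase hi)]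

/-- Replacing a column of a Gaussian design by an independent copy preserves its law. -/
theorem measurePreserving_update_column (j : Fin p) :
    MeasurePreserving (fun q : (Fin n → Fin p → ℝ) × (Fin n → ℝ) =>
        fun i => Function.update (q.1 i) j (q.2 i))
      ((gaussianDesign n p).prod (noiseLaw n 1)) (gaussianDesign n p) := by
  have h1 := (measurePreserving_arrowProdEquivProdArrow (Fin p → ℝ) ℝ (Fin n)
    (fun _ => Measure.pi fun _ : Fin p => gaussianReal 0 1) (fun _ => gaussianReal 0 1)).symm
  have h2 := measurePreserving_update_pi (gaussianReal 0 1) j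
  have h3 : MeasurePreserving (fun x : Fin n → (Fin p → ℝ) × ℝ =>
      fun i => Function.update (x i).1 j (x i).2)
      (Measure.pi fun _ : Fin n => (Measure.pi fun _ : Fin p => gaussianReal 0 1).prod
        (gaussianReal 0 1))
      (Measure.pi fun _ : Fin n => Measure.pi fun _ : Fin p => gaussianReal 0 1) := by
    refine ⟨measurable_pi_lambda _ fun i => h2.measurable.comp (measurable_pi_apply i), ?_⟩
    have : ∀ i : Fin n, SigmaFinite (((fun _ : Fin n => (Measure.pi fun _ : Fin p =>
        gaussianReal 0 1).prod (gaussianReal 0 1)) i).map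
        (fun q : (Fin p → ℝ) × ℝ => Function.update q.1 j q.2)) := by
      intro i; simp only [h2.map_eq]; infer_instance
    rw [Measure.pi_map_pi (f := fun _ (q : (Fin p → ℝ) × ℝ) => Function.update q.1 j q.2)
      fun _ => h2.measurable.aemeasurable]
    simp only [h2.map_eq]
  rw [gaussianDesign, noiseLaw_one]
  exact h3.comp h1

/-! ### Measurability -/

theorem measurable_gramLift_apply {Ω : Type*} [MeasurableSpace Ω] {X : Ω → Fin n → Fin p → ℝ}
    (hX : Measurable X) (R : Finset (Fin p)) {r : Ω → R → ℝ} (hr : Measurable r) (i : Fin n) :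
    Measurable fun ω => gramLift (Matrix.of (X ω)) R (r ω) i := by
  have hentry : ∀ i j, Measurable fun ω => X ω i j := fun i j =>
    (measurable_pi_apply j).comp ((measurable_pi_apply i).comp hX)
  have hr' : ∀ j, Measurable fun ω => r ω j := fun j => (measurable_pi_apply j).comp hr
  have hinv : ∀ a b : R, Measurable fun ω =>
      ((subDesign (Matrix.of (X ω)) R)ᵀ * subDesign (Matrix.of (X ω)) R)⁻¹ a b := by
    intro a b
    refine measurable_matrix_inv_apply (fun a b => ?_) a b
    simp only [Matrix.mul_apply, subDesign, Matrix.submatrix_apply, Matrix.transpose_apply,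
      Matrix.of_apply, id]
    fun_prop
  have hsolve : ∀ a : R, Measurable fun ω => gramSolve (Matrix.of (X ω)) R (r ω) a := fun a =>
    Finset.measurable_fun_sum _ fun b _ => (hinv a b).mul (hr' b)
  exact Finset.measurable_fun_sum _ fun a _ => (hentry i a).mul (hsolve a)

theorem measurable_noiseDirection (S : Finset (Fin p)) (j : Fin p) :
    Measurable fun X : Fin n → Fin p → ℝ => noiseDirection (Matrix.of X) S j := by
  refine measurable_pi_lambda _ fun i => ?_
  by_cases hj : j ∈ S
  · simp only [noiseDirection, dif_pos hj]
    exact measurable_gramLift_apply measurable_id S measurable_const i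
  · simp only [noiseDirection, dif_neg hj, Pi.sub_apply]
    refine Measurable.sub (by simp only [Matrix.col_apply, Matrix.of_apply]; fun_prop)
      (measurable_gramLift_apply measurable_id S (measurable_pi_lambda _ fun l => ?_) i)
    simp only [mulVec, dotProduct, subDesign, Matrix.transpose_apply, Matrix.submatrix_apply,
      Matrix.col_apply, Matrix.of_apply, id]
    fun_prop

/-! ### The Lasso for a Gaussian design -/

/-- A column of the design is nearly orthogonal to short vectors built from the others. -/
theorem gaussianDesign_gramLift_le (s : Fin p → ℝ) {R : Finset (Fin p)} {j : Fin p} (hj : j ∉ R)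
    {V t : ℝ} (ht : 0 < t) (htV : t * √V ≤ 1 / 2) :
    gaussianDesign n p {X | ∑ i, gramLift (Matrix.of X) R (fun i => s i) i ^ 2 ≤ V ∧
        1 / 2 < |((Matrix.of X)ᵀ *ᵥ gramLift (Matrix.of X) R (fun i => s i)) j|}
      ≤ ENNReal.ofReal (Real.exp (-t ^ 2 / 2) / t) := by
  have hlift : ∀ i, Measurable fun X : Fin n → Fin p → ℝ =>
      gramLift (Matrix.of X) R (fun i => s i) i :=
    fun i => measurable_gramLift_apply measurable_id R measurable_const i
  have hsq : Measurable fun X : Fin n → Fin p → ℝ =>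
      ∑ i, gramLift (Matrix.of X) R (fun i => s i) i ^ 2 := by fun_prop
  have hdot : Measurable fun X : Fin n → Fin p → ℝ =>
      ((Matrix.of X)ᵀ *ᵥ gramLift (Matrix.of X) R (fun i => s i)) j := by
    simp only [mulVec, dotProduct, Matrix.transpose_apply, Matrix.of_apply]
    fun_prop
  have hmeas : MeasurableSet {X : Fin n → Fin p → ℝ |
      ∑ i, gramLift (Matrix.of X) R (fun i => s i) i ^ 2 ≤ V ∧
        1 / 2 < |((Matrix.of X)ᵀ *ᵥ gramLift (Matrix.of X) R (fun i => s i)) j|} :=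
    (measurableSet_le hsq measurable_const).inter
      (measurableSet_lt measurable_const (measurable_norm.comp hdot))
  -- Resampling column `j` leaves the lifted vector `w` unchanged. Given the other columns, the
  -- product is a Gaussian linear form of variance `‖w‖²`, and the section of the event is empty
  -- when this exceeds `V`.
  have hmp := measurePreserving_update_column (n := n) j
  rw [← hmp.measure_preimage hmeas.nullMeasurableSet]
  refine (measure_prod_le_add _ _ (hmp.measurable hmeas) ∅
    (q := ENNReal.ofReal (Real.exp (-t ^ 2 / 2) / t)) fun X _ => ?_).trans (by simp)
  set w := gramLift (Matrix.of X) R (fun i => s i) with hw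
  have hsub : ∀ g : Fin n → ℝ,
      subDesign (Matrix.of fun i => Function.update (X i) j (g i)) R = subDesign (Matrix.of X) R := by
    intro g
    ext i l
    have : (l : Fin p) ≠ j := fun h => hj (h ▸ l.2)
    simp [subDesign, this]
  have hwg : ∀ g : Fin n → ℝ,
      gramLift (Matrix.of fun i => Function.update (X i) j (g i)) R (fun i => s i) = w := by
    intro g
    rw [hw, gramLift, gramLift, gramSolve, gramSolve, hsub]
  by_cases hV : ∑ i, w i ^ 2 ≤ V
  · refine (measure_mono fun g hg => ?_).trans (noiseLaw_tail_le one_pos w hV ht)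
    have hg' := hg.2
    simp only [hwg] at hg'
    show t * (1 * √V) < |w ⬝ᵥ g|
    rw [one_mul]
    refine htV.trans_lt (hg'.trans_eq ?_)
    rw [dotProduct_comm]
    simp [mulVec, dotProduct]
  · refine le_trans (le_of_eq ?_) zero_le
    convert measure_empty (μ := noiseLaw n 1)
    ext g
    simp only [Set.mem_preimage, Set.mem_ofPred_eq, hwg, Set.mem_empty_iff_false, iff_false,
      not_and]
    exact fun h => absurd h hV

theorem exp_div_le_of_one_le {t L : ℝ} (h1 : 1 ≤ t) (h2 : 4 * L ≤ t ^ 2) :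
    Real.exp (-t ^ 2 / 2) / t ≤ Real.exp (-(2 * L)) :=
  (div_le_self (Real.exp_pos _).le h1).trans (Real.exp_le_exp.2 (by linarith))

theorem sum_sq_sign_le (S : Finset (Fin p)) (β : Fin p → ℝ) :
    ∑ i : S, (SignType.sign (β i) : ℝ) ^ 2 ≤ S.card := by
  calc ∑ i : S, (SignType.sign (β i) : ℝ) ^ 2 ≤ ∑ _i : S, (1 : ℝ) := by
        refine Finset.sum_le_sum fun i _ => ?_
        rcases lt_trichotomy (β i) 0 with h | h | h <;> simp [h]
    _ = S.card := by simp

theorem sum_sq_noiseDirection_le {c : ℝ} {m : ℕ} {X : Matrix (Fin n) (Fin p) ℝ}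
    {S : Finset (Fin p)} (hc : 0 < c) (hn : 0 < n) (hX : SparseLowerBound c m X)
    (hS : S.card ≤ m) (j : Fin p) :
    (j ∈ S → ∑ i, noiseDirection X S j i ^ 2 ≤ 1 / (c * n)) ∧
      (j ∉ S → ∑ i, noiseDirection X S j i ^ 2 ≤ ∑ i, X i j ^ 2) := by
  constructor
  · intro hj
    rw [noiseDirection, dif_pos hj]
    refine (sum_sq_gramLift_le hc hn hX hS _).trans (le_of_eq ?_)
    simp [Pi.single_apply]
  · intro hj
    rw [noiseDirection, dif_neg hj]
    exact sum_sq_sub_gramLift_le hc hn hX hS (X.col j)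

/-- Ensures `t ≥ 1` as soon as `t² ≥ 4 log p`, so the denominator in Mills' bound can be dropped. -/
theorem quarter_le_log (hp : 2 ≤ p) : 1 / 4 ≤ Real.log p := by
  have h1 : Real.log 2 ≤ Real.log p :=
    Real.log_le_log two_pos (by exact_mod_cast hp)
  linarith [Real.log_two_gt_d9]

/-- The conditions on the design under which the Lasso recovers the support of `βstar`. -/
def GoodDesign (k : ℕ) (βstar : Fin p → ℝ) (S : Finset (Fin p))
    (X : Matrix (Fin n) (Fin p) ℝ) : Prop :=
  SparseLowerBound (1 / 9) (2 * k) X ∧ (∀ j, ∑ i, X i j ^ 2 ≤ 2 * n) ∧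
    ∀ j, |(Xᵀ *ᵥ gramLift X (S.erase j) (fun i => (SignType.sign (βstar i) : ℝ))) j| ≤ 1 / 2

theorem gaussianDesign_not_goodDesign_le (hp : 2 ≤ p) {k : ℕ} (hk : 1 ≤ k)
    (hn : 704 * (k * Real.log p) ≤ n) (βstar : Fin p → ℝ) {S : Finset (Fin p)}
    (hS : S.card ≤ k) :
    gaussianDesign n p {X | ¬ GoodDesign k βstar S (Matrix.of X)} ≤ ENNReal.ofReal (6 / p) := by
  have hL := log_natCast_pos hp
  have hL4 := quarter_le_log hp
  have hp0 : (0 : ℝ) < p := by exact_mod_cast (by omega : 0 < p)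
  have hk1 : (1 : ℝ) ≤ k := by exact_mod_cast hk
  have hkL : Real.log p ≤ k * Real.log p := le_mul_of_one_le_left hL.le hk1
  have hn0 : (0 : ℝ) < n := lt_of_lt_of_le (by positivity) hn
  have hnpos : 0 < n := by exact_mod_cast hn0
  set V : ℝ := k / (1 / 9 * n) with hV
  have hV0 : 0 < V := by positivity
  -- The largest `t` with `t √V ≤ 1/2`; then `t² = n / (36k) ≥ (704/36) log p`, well above the `4
  -- log p` needed for a union over columns.
  set t : ℝ := 1 / (2 * √V) with ht
  have hsV : 0 < √V := Real.sqrt_pos.2 hV0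
  have ht0 : 0 < t := by positivity
  have htV : t * √V ≤ 1 / 2 := by rw [ht]; field_simp; norm_num
  have ht2 : t ^ 2 = n / (36 * k) := by
    rw [ht, div_pow, mul_pow, Real.sq_sqrt hV0.le, hV]; field_simp; norm_num
  have ht4 : 4 * Real.log p ≤ t ^ 2 := by
    rw [ht2, le_div_iff₀ (by positivity)]
    have : 0 ≤ k * Real.log p := by positivity
    linarith
  have ht1 : 1 ≤ t := by
    rw [← one_le_sq_iff₀ ht0.le]; linarith
  set W : Fin p → Set (Fin n → Fin p → ℝ) := fun j =>
    {X | ∑ i, gramLift (Matrix.of X) (S.erase j)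
        (fun i => (SignType.sign (βstar i) : ℝ)) i ^ 2 ≤ V ∧
      1 / 2 < |((Matrix.of X)ᵀ *ᵥ gramLift (Matrix.of X) (S.erase j)
        (fun i => (SignType.sign (βstar i) : ℝ))) j|} with hW
  have hsub : {X : Fin n → Fin p → ℝ | ¬ GoodDesign k βstar S (Matrix.of X)}
      ⊆ {X | ¬ SparseLowerBound (1 / 9) (2 * k) (Matrix.of X)} ∪
        ({X | ∃ j, 2 * (n : ℝ) ≤ ∑ i, X i j ^ 2} ∪ ⋃ j ∈ Finset.univ, W j) := by
    intro X hX
    by_contra hcon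
    simp only [Set.mem_union, Set.mem_ofPred_eq, not_or, not_not, not_exists, not_le,
      Set.mem_iUnion, Finset.mem_univ, true_implies] at hcon
    obtain ⟨h1, h2, h3⟩ := hcon
    refine hX ⟨h1, fun j => (h2 j).le, fun j => ?_⟩
    by_contra! h4
    refine h3 j ⟨?_, h4⟩
    have hR : (S.erase j).card ≤ k := Finset.card_erase_le.trans hS
    refine (sum_sq_gramLift_le (by norm_num) hnpos h1 (by omega) _).trans ?_
    rw [hV]
    gcongr
    exact (sum_sq_sign_le _ βstar).trans (by exact_mod_cast hR)
  have hWle : gaussianDesign n p (⋃ j ∈ Finset.univ, W j) ≤ ENNReal.ofReal (1 / p) := by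
    rw [← mul_exp_neg_two_log hp]
    refine measure_biUnion_le_card_mul _ _ (by simp) (by positivity) fun j _ => ?_
    refine (gaussianDesign_gramLift_le (fun i => (SignType.sign (βstar i) : ℝ))
      (Finset.notMem_erase j S) ht0 htV).trans ?_
    exact ENNReal.ofReal_le_ofReal (exp_div_le_of_one_le ht1 ht4)
  have hcol : gaussianDesign n p {X | ∃ j, 2 * (n : ℝ) ≤ ∑ i, X i j ^ 2}
      ≤ ENNReal.ofReal (1 / p) := by
    rw [← mul_exp_neg_two_log hp]
    refine (gaussianDesign_exists_col_ge n p (l := 1 / 4) (by norm_num) le_rfl).trans ?_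
    apply ENNReal.ofReal_le_ofReal
    gcongr
    linarith
  refine (measure_mono hsub).trans ((measure_union_le _ _).trans ((add_le_add
    (gaussianDesign_sparseLowerBound hp hk hn) ((measure_union_le _ _).trans
      (add_le_add hcol hWle))).trans ?_))
  rw [← ENNReal.ofReal_add (by positivity) (by positivity),
    ← ENNReal.ofReal_add (by positivity) (by positivity)]
  exact ENNReal.ofReal_le_ofReal (le_of_eq (by ring))

/-- The largest squared length of the noise direction at the column `j` for a good design. -/
def noiseScale (n : ℕ) (S : Finset (Fin p)) (j : Fin p) : ℝ :=
  if j ∈ S then 1 / (1 / 9 * n) else 2 * n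

/-- The bad designs, of probability at most `6 / p`, are charged twice: as part of the event and as
the exceptional set in Fubini. The noise adds `1 / p`. -/
theorem noiseDirection_tail_le (hp : 2 ≤ p) {k : ℕ} (hk : 1 ≤ k)
    (hn : 704 * (k * Real.log p) ≤ n) (βstar : Fin p → ℝ) {S : Finset (Fin p)}
    (hS : S.card ≤ k) {σ : ℝ} (hσ : 0 < σ) :
    ((gaussianDesign n p).prod (noiseLaw n σ)) {ω | ¬ GoodDesign k βstar S (Matrix.of ω.1) ∨
        ∃ j, 2 * √(Real.log p) * (σ * √(noiseScale n S j))
          < |noiseDirection (Matrix.of ω.1) S j ⬝ᵥ ω.2|}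
      ≤ ENNReal.ofReal (13 / p) := by
  have hL := log_natCast_pos hp
  have hL4 := quarter_le_log hp
  have hp0 : (0 : ℝ) < p := by exact_mod_cast (by omega : 0 < p)
  have hk1 : (1 : ℝ) ≤ k := by exact_mod_cast hk
  have hn0 : (0 : ℝ) < n := lt_of_lt_of_le (by positivity) hn
  have hnpos : 0 < n := by exact_mod_cast hn0
  set t := 2 * √(Real.log p) with ht
  have ht2 : t ^ 2 = 4 * Real.log p := by
    rw [ht, mul_pow, Real.sq_sqrt hL.le]; norm_num
  have ht0 : 0 < t := mul_pos two_pos (Real.sqrt_pos.2 hL)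
  have ht1 : 1 ≤ t := by
    rw [← one_le_sq_iff₀ ht0.le]; linarith
  set G := {X : Fin n → Fin p → ℝ | ¬ GoodDesign k βstar S (Matrix.of X)} with hG
  have hGle := gaussianDesign_not_goodDesign_le hp hk hn βstar hS
  set E := {ω : (Fin n → Fin p → ℝ) × (Fin n → ℝ) | ∃ j, t * (σ * √(noiseScale n S j))
    < |noiseDirection (Matrix.of ω.1) S j ⬝ᵥ ω.2|} with hE
  have hEm : MeasurableSet E := by
    have h : E = ⋃ j, {ω | t * (σ * √(noiseScale n S j))
        < |noiseDirection (Matrix.of ω.1) S j ⬝ᵥ ω.2|} := by ext; simp [hE]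
    rw [h]
    refine MeasurableSet.iUnion fun j => measurableSet_lt measurable_const ?_
    have h1 : Measurable fun ω : (Fin n → Fin p → ℝ) × (Fin n → ℝ) =>
        noiseDirection (Matrix.of ω.1) S j := (measurable_noiseDirection S j).comp measurable_fst
    have h2 : Measurable fun ω : (Fin n → Fin p → ℝ) × (Fin n → ℝ) =>
        noiseDirection (Matrix.of ω.1) S j ⬝ᵥ ω.2 := by
      simp only [dotProduct]
      fun_prop
    exact measurable_norm.comp h2
  have hEle : ((gaussianDesign n p).prod (noiseLaw n σ)) E
      ≤ gaussianDesign n p G + ENNReal.ofReal (1 / p) := by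
    refine measure_prod_le_add _ _ hEm G fun X hX => ?_
    obtain ⟨h1, h2, -⟩ := not_not.1 hX
    have hset : Prod.mk X ⁻¹' E = ⋃ j ∈ Finset.univ, {ε | t * (σ * √(noiseScale n S j))
        < |noiseDirection (Matrix.of X) S j ⬝ᵥ ε|} := by ext; simp [hE]
    rw [hset, ← mul_exp_neg_two_log hp]
    refine measure_biUnion_le_card_mul _ _ (by simp) (by positivity) fun j _ => ?_
    refine (noiseLaw_tail_le hσ _ ?_ ht0).trans
      (ENNReal.ofReal_le_ofReal (exp_div_le_of_one_le ht1 ht2.ge))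
    have h3 := sum_sq_noiseDirection_le (by norm_num) hnpos h1 (show S.card ≤ 2 * k by omega) j
    unfold noiseScale
    split_ifs with hj
    · exact h3.1 hj
    · exact (h3.2 hj).trans (h2 j)
  have hcover : {ω : (Fin n → Fin p → ℝ) × (Fin n → ℝ) |
      ¬ GoodDesign k βstar S (Matrix.of ω.1) ∨ ∃ j, t * (σ * √(noiseScale n S j))
        < |noiseDirection (Matrix.of ω.1) S j ⬝ᵥ ω.2|} ⊆ G ×ˢ Set.univ ∪ E := by
    rintro ω (h | h)
    · exact Or.inl ⟨h, trivial⟩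
    · exact Or.inr h
  refine (measure_mono hcover).trans ((measure_union_le _ _).trans ?_)
  rw [Measure.prod_prod, measure_univ, mul_one]
  refine (add_le_add hGle (hEle.trans (add_le_add_left hGle _))).trans ?_
  rw [← ENNReal.ofReal_add (by positivity) (by positivity),
    ← ENNReal.ofReal_add (by positivity) (by positivity)]
  exact ENNReal.ofReal_le_ofReal (le_of_eq (by ring))

theorem lasso_gaussian_design :
    ∃ a₀ : ℝ, 0 < a₀ ∧ ∀ a : ℝ, a₀ ≤ a → ∃ C₀ Cβ C C' : ℝ, 0 < C₀ ∧ 0 < Cβ ∧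
      ∀ (n p k : ℕ), 2 ≤ p → 1 ≤ k → C₀ * (k * Real.log p) ≤ n → ∀ σ : ℝ, 0 < σ →
      ∀ βstar : Fin p → ℝ, {j | βstar j ≠ 0}.ncard ≤ k →
        (∀ j, βstar j ≠ 0 → Cβ * (σ * √(Real.log p / n)) ≤ |βstar j|) →
        ((gaussianDesign n p).prod (noiseLaw n σ))
          {ω | ¬ ((∃ b, IsLasso (Matrix.of ω.1) ((Matrix.of ω.1).mulVec βstar + ω.2)
                (a * σ * √(n * Real.log p)) b) ∧
              ∀ b, IsLasso (Matrix.of ω.1) ((Matrix.of ω.1).mulVec βstar + ω.2)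
                (a * σ * √(n * Real.log p)) b →
                (∀ j, βstar j ≠ 0 → b j ≠ 0) ∧
                ({j | b j ≠ 0 ∧ βstar j = 0}.ncard : ℝ) ≤ C * k)}
          ≤ ENNReal.ofReal (C' / p) := by
  -- `12` exceeds `8√2`, which gives `4D < lam`. `7 + 7a` exceeds `6 + 27a/4`, the noise plus the
  -- shrinkage on the support. Recovery is exact, so the false positive constant is `0`.
  refine ⟨12, by norm_num, fun a ha => ⟨704, 7 + 7 * a, 0, 13, by norm_num, by linarith, ?_⟩⟩
  intro n p k hp hk hn σ hσ βstar hβk hβmin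
  have hL := log_natCast_pos hp
  have hk1 : (1 : ℝ) ≤ k := by exact_mod_cast hk
  have hn0 : (0 : ℝ) < n := lt_of_lt_of_le (by positivity) hn
  have hnpos : 0 < n := by exact_mod_cast hn0
  set S := Finset.univ.filter fun j => βstar j ≠ 0 with hSdef
  have hβS : ∀ j, j ∈ S ↔ βstar j ≠ 0 := fun j => by simp [hSdef]
  have hS : S.card ≤ k := by
    rw [← Set.ncard_coe_finset]; simpa [hSdef] using hβk
  refine (measure_mono fun ω hω => ?_).trans (noiseDirection_tail_le hp hk hn βstar hS hσ)
  by_contra hcon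
  simp only [Set.mem_ofPred_eq, not_or, not_not, not_exists, not_lt] at hcon
  obtain ⟨⟨hX, -, hw⟩, hnoise⟩ := hcon
  set r := √(Real.log p / n) with hr
  have hr0 : 0 < r := Real.sqrt_pos.2 (by positivity)
  have hsn : √(n * Real.log p) = n * r := by
    rw [hr, ← Real.sqrt_sq hn0.le, ← Real.sqrt_mul (sq_nonneg _), Real.sqrt_sq hn0.le]
    congr 1; field_simp
  have hin : √(Real.log p) * √(1 / (1 / 9 * n)) = 3 * r := by
    rw [hr, ← Real.sqrt_mul hL.le, show (3 : ℝ) = √(3 ^ 2) by rw [Real.sqrt_sq]; norm_num,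
      ← Real.sqrt_mul (by norm_num)]
    congr 1; field_simp; norm_num
  have hout : √(Real.log p) * √(2 * n) = √2 * (n * r) := by
    rw [← hsn, ← Real.sqrt_mul hL.le, ← Real.sqrt_mul zero_le_two]
    congr 1; ring
  have hsqrt2 : √2 < 3 / 2 := by
    rw [Real.sqrt_lt' (by norm_num)]; norm_num
  have hσnr : 0 < σ * (n * r) := by positivity
  have hlam : 0 < a * σ * √(n * Real.log p) := by
    rw [hsn]; have : 0 < a := by linarith
    positivity
  obtain ⟨hex, hall⟩ := lasso_support_recovery (lam := a * σ * √(n * Real.log p))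
    (A := 6 * (σ * r)) (D := 2 * √2 * (σ * (n * r))) (c := 1 / 9) (by norm_num) hnpos hX
    (show S.card ≤ 2 * k by omega) hβS (ε := ω.2) hlam
    (by rw [hsn]; nlinarith)
    (fun j hj => by
      refine lt_of_lt_of_le ?_ (hβmin j ((hβS j).1 hj))
      have : 3 * (a * σ * √(n * Real.log p)) / (4 * (1 / 9 * n)) = 27 / 4 * a * (σ * r) := by
        rw [hsn]; field_simp; norm_num
      rw [this]
      have h1 : 0 < σ * r := by positivity
      nlinarith)
    hw
    (fun j hj => by
      refine (hnoise j).trans (le_of_eq ?_)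
      rw [noiseScale, if_pos hj,
        show 2 * √(Real.log p) * (σ * √(1 / (1 / 9 * n)))
          = 2 * σ * (√(Real.log p) * √(1 / (1 / 9 * n))) by ring, hin]
      ring)
    (fun j hj => by
      refine (hnoise j).trans (le_of_eq ?_)
      rw [noiseScale, if_neg hj,
        show 2 * √(Real.log p) * (σ * √(2 * n)) = 2 * σ * (√(Real.log p) * √(2 * n)) by ring, hout]
      ring)
  refine hω ⟨hex, fun b hb => ⟨fun j hj => (hall b hb j).2 hj, ?_⟩⟩
  have hempty : {j | b j ≠ 0 ∧ βstar j = 0} = ∅ := by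
    ext j
    simp only [Set.mem_ofPred_eq, Set.mem_empty_iff_false, iff_false, not_and]
    exact fun h => (hall b hb j).1 h
  rw [hempty]
  simp

end WarmStart

end

theorem mainTheorem8 :
    -- Noise condition, fixed design with columns of squared norm at most `n`
    (∃ C : ℝ, ∀ (n p : ℕ), 2 ≤ p → ∀ (σ τ₁ s : ℝ), 0 < σ → 0 < τ₁ → 0 ≤ s →
      ∀ X : Matrix (Fin n) (Fin p) ℝ, (∀ j, ∑ i, X i j ^ 2 ≤ (n : ℝ)) →
      ∀ zstar : Finset (Fin p),
        WarmStart.noiseLaw n σ {ε | ¬ WarmStart.NoiseBound σ τ₁ s zstar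
          (σ * √(2 * (s + 1) * n * Real.log p)) X ε}
          ≤ ENNReal.ofReal (C / √(Real.log p))) ∧
    -- Noise condition, Gaussian design, up to a factor `1 + η`
    (∀ η : ℝ, 0 < η → ∃ C₀ C : ℝ, 0 < C₀ ∧ ∀ (n p : ℕ), 2 ≤ p → C₀ * Real.log p ≤ n →
      ∀ (σ τ₁ s : ℝ), 0 < σ → 0 < τ₁ → 0 ≤ s → ∀ zstar : Finset (Fin p),
        ((WarmStart.gaussianDesign n p).prod (WarmStart.noiseLaw n σ))
          {ω | ¬ WarmStart.NoiseBound σ τ₁ s zstar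
            ((1 + η) * (σ * √(2 * (s + 1) * n * Real.log p))) (Matrix.of ω.1) ω.2}
          ≤ ENNReal.ofReal (C / √(Real.log p))) ∧
    -- Noise condition, Gaussian design, exact constant, when `(log p)² ≲ n`
    (∀ κ s η : ℝ, 0 < κ → 0 ≤ s → 0 < η → ∃ p₀ : ℕ, ∀ (n p : ℕ), p₀ ≤ p →
      Real.log p ^ 2 ≤ κ * n → ∀ (σ τ₁ : ℝ), 0 < σ → 0 < τ₁ → ∀ zstar : Finset (Fin p),
        ((WarmStart.gaussianDesign n p).prod (WarmStart.noiseLaw n σ))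
          {ω | ¬ WarmStart.NoiseBound σ τ₁ s zstar
            (σ * √(2 * (s + 1) * n * Real.log p)) (Matrix.of ω.1) ω.2}
          ≤ ENNReal.ofReal η) ∧
    -- Coherence, when `k ≍ n / log p`
    (∀ c₀ κ : ℝ, 0 < c₀ → 0 < κ → ∃ C C' : ℝ, ∀ (n p k : ℕ), 2 ≤ p → 1 ≤ k →
      c₀ * (k * Real.log p) ≤ n → (n : ℝ) ≤ κ * (k * Real.log p) →
      ∀ (σ τ₁ : ℝ), 0 < σ → 0 < τ₁ →
        WarmStart.gaussianDesign n p
          {X | ¬ WarmStart.coherence σ τ₁ (Matrix.of X) k ≤ C * ((k : ℝ) ^ 2 * Real.log p)}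
          ≤ ENNReal.ofReal (C' / p)) ∧
    -- Restricted eigenvalue
    (∃ C₀ c C : ℝ, 0 < C₀ ∧ 0 < c ∧ ∀ (n p k : ℕ), 2 ≤ p → 1 ≤ k →
      C₀ * (k * Real.log p) ≤ n → ∀ (σ τ₁ : ℝ), 0 < σ → 0 < τ₁ →
        WarmStart.gaussianDesign n p
          {X | ¬ c * (n : ℝ) ≤ WarmStart.restrictedEigenvalue σ τ₁ (Matrix.of X) k}
          ≤ ENNReal.ofReal (C / p)) ∧
    -- Lasso
    (∃ a₀ : ℝ, 0 < a₀ ∧ ∀ a : ℝ, a₀ ≤ a → ∃ C₀ Cβ C C' : ℝ, 0 < C₀ ∧ 0 < Cβ ∧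
      ∀ (n p k : ℕ), 2 ≤ p → 1 ≤ k → C₀ * (k * Real.log p) ≤ n → ∀ σ : ℝ, 0 < σ →
      ∀ βstar : Fin p → ℝ, {j | βstar j ≠ 0}.ncard ≤ k →
        (∀ j, βstar j ≠ 0 → Cβ * (σ * √(Real.log p / n)) ≤ |βstar j|) →
        ((WarmStart.gaussianDesign n p).prod (WarmStart.noiseLaw n σ))
          {ω | ¬ ((∃ b, WarmStart.IsLasso (Matrix.of ω.1) ((Matrix.of ω.1).mulVec βstar + ω.2)
                (a * σ * √(n * Real.log p)) b) ∧
              ∀ b, WarmStart.IsLasso (Matrix.of ω.1) ((Matrix.of ω.1).mulVec βstar + ω.2)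
                (a * σ * √(n * Real.log p)) b →
                (∀ j, βstar j ≠ 0 → b j ≠ 0) ∧
                ({j | b j ≠ 0 ∧ βstar j = 0}.ncard : ℝ) ≤ C * k)}
          ≤ ENNReal.ofReal (C' / p)) :=
  ⟨WarmStart.noise_condition_fixed_design, WarmStart.noise_condition_gaussian_design,
    WarmStart.noise_condition_gaussian_design_exact, WarmStart.coherence_gaussian_design,
    WarmStart.restrictedEigenvalue_gaussian_design, WarmStart.lasso_gaussian_design⟩
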